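/- **Setting.** Let $V=[m]$, let $\overline{\mathcal X}\subset\mathbb R^{\overline d}$ be nonempty, closed and convex, and let $f_v:\overline{\mathcal X}\to\mathbb R$ ($v\in V$) be convex functions with subgradient oracles $f_v'$ such that, for constants $\mu_f,M_f>0$, all $v\in V$ and all $x,x'\in\overline{\mathcal X}$, $$\tfrac{\mu_f}{2}\|x-x'\|^2\le f_v(x)-f_v(x')-\langle f_v'(x'),x-x'\rangle\le M_f\|x-x'\|.$$ All norms are Euclidean and $D(x,z)=\tfrac12\|x-z\|^2$. Let $x^*$ minimize $\sum_v f_v$ over $\overline{\mathcal X}$, and put $X^*=(x^*)_{v\in V}$, $\mathcal X=\overline{\mathcal X}^{V}$, $F(X)=\sum_v f_v(x_v)$, $\Pi(X)_v=\frac1m\sum_{v'}x_{v'}$. A point $X\in\mathcal X$ is an $(\epsilon,\delta)$-solution if $F(X)\le F(X^*)+\epsilon$ and $\|(I-\Pi)X\|\le\delta$. Let $S\ge1$, let $K_s:\mathbb R^{m\overline d}\to\mathbb R^{n_s}$ ($s\in[S]$) be nonzero linear maps, and let $KX=(K_sX)_{s}$; assume that $KX=0$ iff all $x_v$ are equal.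 Let $\Pi_s=K_s^*(K_sK_s^*)^\dagger K_s$, $\sigma^+_{\min}(K_s)=\min_{\Pi_sX\ne0}\|K_sX\|/\|\Pi_sX\|$, and define $\sigma^+_{\min}(K)$ in the same way from $K$. Let $r_s\ge1$ be integers, the updating rates. *Similarity.* $\{f_v\}$ is $\widehat a_1$-similar if there is $\nabla F:\mathcal X\to\mathbb R^{m\overline d}$ with $(\nabla F(X))_v\in\partial f_v(x_v)$ and $\|(I-\Pi)\nabla F(X)\|\le\widehat a_1$ for all $X\in\mathcal X$ with $KX=0$. It is $\{(a_s,K_s)\}_s$-similar if $K_sK_{s'}^*=0$ for $s\ne s'$ and there is such a $\nabla F$ with $\|\Pi_s\nabla F(X)\|\le a_s$ for all $s$ and all $X\in\mathcal X$ with $KX=0$. *Gradient sliding.* For parameters $\eta_i\ge0$ with $\eta=\sum_i\eta_i>0$, $GS(\phi,U,T,(\eta_i),w,(x_i),u^0)$ denotes the pair $(u^T,\widehat u^T)$, where for $1\le t\le T$ $$u^t=\operatorname{argmin}_{u\in U}\ \langle w+\phi'(u^{t-1}),u\rangle+\sum_i\eta_iD(u,x_i)+\eta\beta_tD(u,u^{t-1}),\qquad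 \widehat u^T=\frac{\sum_{t=1}^T t\,u^t}{\sum_{t=1}^T t},\qquad \beta_t=\frac{(t+1)\mu_f}{2\eta}+\frac{t-1}{2}.$$ *Method.* Given a probability vector $\rho$ on $[S]$, penalties $R_s:\mathbb R^{n_s}\to\mathbb R$, and $\widetilde a>0$, write $\overline{r^j}=\sum_s\rho_sr_s^j$, $\overline r=\overline{r^1}$, $\theta_k=k+2\,\overline{r^2}/\overline r$, $\eta_k=\frac{\mu_f}{2\overline r}(k+\overline{r^2}/\overline r)$, $\tau_s=\frac{\|K_s\|^2}{\rho_s}\cdot\frac{4r_s\overline r}{\mu_f}$. Initialize $x_v^{init}$ as the second component of $GS(f_v,\overline{\mathcal X},\underline T,\underline\eta,0,\underline x_v^0,\underline x_v^0)$, where $\underline x_v^0\in\overline{\mathcal X}$, $\sup_{x\in\overline{\mathcal X}}D(x,\underline x_v^0)\le\underline D^x$ with $0<\underline D^x<\infty$, $\epsilon_0=\widetilde a^2/\mu_f$, $\underline T\ge\frac{8M_f^2m}{\epsilon_0\mu_f}$, $\underline\eta=\frac{\epsilon_0/2}{m\underline D^x}$. Let $X^k=\widehat X^k=X^{init}$ for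 $k<0$ and $y_s^{i}=0$ for $i<0$, and let $N$ be such that $r_s\mid N+1$ for all $s$. At each time $k=0,\dots,N$: for every $s$ with $k=r_si$, $$\widetilde X_s^i=\sum_{k'=k-r_s}^{k-1}\theta_{k'}(\widehat X^{k'}-X^{k'-r_s})+\sum_{k'=k-r_s}^{k-1}\theta_{k'+r_s}X^{k'},$$ $$y_s^i\in\operatorname{argmin}_{y}\ -\frac{\langle K_s\widetilde X_s^i,y\rangle}{\sum_{k'=k}^{k+r_s-1}\theta_{k'}}+R_s^*(y)+\frac{\tau_s}{\sum_{k'=k}^{k+r_s-1}\theta_{k'}}D(y,y_s^{i-1});$$ then every agent $v$ sets $$(x_v^k,\widehat x_v^k)=GS\Big(f_v,\overline{\mathcal X},T,(\eta_k\rho_s)_s,\big(\textstyle\sum_sK_s^*y_s^{\lfloor k/r_s\rfloor}\big)_v,(x_v^{k-r_s})_s,x_v^{k-1}\Big).$$ Here $T/N\ge\max\big(\frac{5}{\sqrt{D_1}},\frac{64\overline r}{D_1}\big)$ with $D_1=\frac{\mu_f^2(\overline{r^2}/\overline r)^2}{2mM_f^2}\cdot\frac{4\widetilde a^2}{\mu_f^2}$.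 Put $\overline X^N=\sum_{k=0}^N\theta_k\widehat X^k\big/\sum_{k=0}^N\theta_k$. **Statement.** Let $\xi,\epsilon>0$. In each case below, with the stated $\rho$, $R_s$, $A_0$, $A_1$ and with $\widetilde a=A_1$, suppose $$N\ge B:=\frac{2\,\overline r\,A}{\sqrt{\mu_f\,\epsilon}},\qquad A=\sqrt{\frac{\overline{r^3}}{(\overline r)^3}+7\Big(\frac{\overline{r^2}}{(\overline r)^2}\Big)^2}\;A_1+A_0 .$$ 1. If $\{f_v\}$ is $\widehat a_1$-similar with $\widehat a_1>0$, take $A_1=\widehat a_1$ and $\rho_s=\|K_s\|/\sum_{s'}\|K_{s'}\|$. (a) If $R_s(y)=\frac{\xi+\widehat a_1}{\sigma^+_{\min}(K)}\|y\|$ and $A_0=\frac{\sum_s\|K_s\|}{\sigma^+_{\min}(K)}(\xi+\widehat a_1)$, then $\overline X^N$ is an $(\epsilon,\epsilon/\xi)$-solution. (b) If $R_s(y)=\frac{(1+\xi)\widehat a_1}{\sigma^+_{\min}(K)}\|y\|$ and $A_0=\frac{(1+\xi)(\sum_s\|K_s\|)\widehat a_1}{\sigma^+_{\min}(K)}$,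 then $\Pi\overline X^N$ is an $(\epsilon(1+1/\xi),0)$-solution. 2. If $\{f_v\}$ is $\{(a_s,K_s)\}_s$-similar with all $a_s>0$, take $A_1=(\sum_sa_s^2)^{1/2}$. (a) If $R_s(y)=\frac{\xi+a_s}{\sigma^+_{\min}(K_s)}\|y\|$, $\rho_s\propto\|K_s\|\frac{\xi+a_s}{\sigma^+_{\min}(K_s)}$ and $A_0=\sum_s(\xi+a_s)\frac{\|K_s\|}{\sigma^+_{\min}(K_s)}$, then $\overline X^N$ is an $(\epsilon,\epsilon/\xi)$-solution. (b) If $R_s(y)=\frac{(1+\xi)a_s}{\sigma^+_{\min}(K_s)}\|y\|$, $\rho_s\propto\|K_s\|\frac{a_s}{\sigma^+_{\min}(K_s)}$ and $A_0=(1+\xi)\sum_sa_s\frac{\|K_s\|}{\sigma^+_{\min}(K_s)}$, then $\Pi\overline X^N$ is an $(\epsilon(1+1/\xi),0)$-solution. Moreover, in each case there is an $N\ge B$ with $r_s\mid N+1$ for all $s$ for which the number of communication rounds (times $k\le N$ at which some dual block is updated) is at most $B+1+\operatorname{lcm}(r_1,\dots,r_S)$, i.e. $O(1/\sqrt{\mu_f\epsilon})$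 rounds with linear dependence on $A$. -/

import Mathlib

noncomputable section

namespace AMT

/-! ### Moore-Penrose inverse -/

section MoorePenrose

variable {E F : Type*} [NormedAddCommGroup E] [InnerProductSpace ℝ E]
  [NormedAddCommGroup F] [InnerProductSpace ℝ F]

/-- The four Penrose equations: `B` is the Moore-Penrose inverse of `A`. -/
structure IsMoorePenrose (A : E →L[ℝ] F) (B : F →L[ℝ] E) : Prop where
  mul_mul_left : ∀ x, A (B (A x)) = A x
  mul_mul_right : ∀ y, B (A (B y)) = B y
  symm_left : ∀ y y', inner ℝ (A (B y)) y' = inner ℝ y (A (B y'))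
  symm_right : ∀ x x', inner ℝ (B (A x)) x' = inner ℝ x (B (A x'))

theorem IsMoorePenrose.unique {A : E →L[ℝ] F} {B C : F →L[ℝ] E}
    (hB : IsMoorePenrose A B) (hC : IsMoorePenrose A C) : B = C := by
  have h1 : ∀ y, A (B y) = A (C y) := by
    intro y
    refine ext_inner_right ℝ fun z => ?_
    calc inner ℝ (A (B y)) z = inner ℝ (A (C (A (B y)))) z := by rw [hC.mul_mul_left]
      _ = inner ℝ y (A (B (A (C z)))) := by rw [hC.symm_left, hB.symm_left]
      _ = inner ℝ (A (C y)) z := by rw [hB.mul_mul_left, hC.symm_left]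
  have h2 : ∀ x, B (A x) = C (A x) := by
    intro x
    refine ext_inner_right ℝ fun z => ?_
    calc inner ℝ (B (A x)) z = inner ℝ (B (A (C (A x)))) z := by rw [hC.mul_mul_left]
      _ = inner ℝ x (C (A (B (A z)))) := by rw [hB.symm_right, hC.symm_right]
      _ = inner ℝ (C (A x)) z := by rw [hB.mul_mul_left, hC.symm_right]
  ext1 y
  rw [← hB.mul_mul_right, h2, h1, hC.mul_mul_right]

variable [FiniteDimensional ℝ E] [FiniteDimensional ℝ F]

theorem exists_isMoorePenrose (A : E →L[ℝ] F) : ∃ B : F →L[ℝ] E, IsMoorePenrose A B := by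
  classical
  let P : Submodule ℝ E := (LinearMap.ker A.toLinearMap)ᗮ
  let Q : Submodule ℝ F := LinearMap.range A.toLinearMap
  have hAP : ∀ x, A (P.starProjection x) = A x := by
    intro x
    have h : x - P.starProjection x ∈ Pᗮ := Submodule.sub_starProjection_mem_orthogonal x
    rw [Submodule.orthogonal_orthogonal] at h
    have h' : A (x - P.starProjection x) = 0 := h
    rw [map_sub, sub_eq_zero] at h'
    exact h'.symm
  let g : P →ₗ[ℝ] Q := LinearMap.codRestrict Q (A.toLinearMap ∘ₗ P.subtype) fun x => ⟨x, rfl⟩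
  have hg : ∀ p : P, ((g p : Q) : F) = A p := fun p => rfl
  have hinj : Function.Injective g := by
    rw [← LinearMap.ker_eq_bot, LinearMap.ker_eq_bot']
    intro p hp
    have h0 : A (p : E) = 0 := by rw [← hg, hp]; rfl
    have h1 : inner ℝ (p : E) (p : E) = 0 :=
      (Submodule.mem_orthogonal _ _).1 p.2 (p : E) h0
    exact Subtype.ext (inner_self_eq_zero.1 h1)
  have hsurj : Function.Surjective g := by
    rintro ⟨_, x, rfl⟩
    refine ⟨⟨P.starProjection x, Submodule.starProjection_apply_mem P x⟩, Subtype.ext ?_⟩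
    exact hAP x
  let e : P ≃ₗ[ℝ] Q := LinearEquiv.ofBijective g ⟨hinj, hsurj⟩
  let B : F →L[ℝ] E := LinearMap.toContinuousLinearMap
    (P.subtype ∘ₗ e.symm.toLinearMap ∘ₗ Q.orthogonalProjectionOnto.toLinearMap)
  have hB : ∀ y, B y = (e.symm (Q.orthogonalProjectionOnto y) : E) := fun y => rfl
  have hAB : ∀ y, A (B y) = Q.starProjection y := by
    intro y
    rw [hB, ← hg]
    change ((e (e.symm _) : Q) : F) = _
    rw [LinearEquiv.apply_symm_apply]
    rfl
  have hBA : ∀ x, B (A x) = P.starProjection x := by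
    intro x
    have h1 : Q.orthogonalProjectionOnto (A x) = e ⟨P.starProjection x,
        Submodule.starProjection_apply_mem P x⟩ := by
      apply Subtype.ext
      change Q.starProjection (A x) = A (P.starProjection x)
      rw [hAP]
      exact Submodule.starProjection_eq_self_iff.2 ⟨x, rfl⟩
    rw [hB, h1, LinearEquiv.symm_apply_apply]
  refine ⟨B, ?_, ?_, ?_, ?_⟩
  · intro x
    rw [hBA, hAP]
  · intro y
    rw [hBA]
    exact Submodule.starProjection_eq_self_iff.2 (by rw [hB]; exact Subtype.mem _)
  · intro y y'
    rw [hAB, hAB]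
    exact Submodule.inner_starProjection_left_eq_right _ _ _
  · intro x x'
    rw [hBA, hBA]
    exact Submodule.inner_starProjection_left_eq_right _ _ _

/-- The Moore-Penrose inverse `A†`. -/
def pinv (A : E →L[ℝ] F) : F →L[ℝ] E := Classical.choose (exists_isMoorePenrose A)

theorem isMoorePenrose_pinv (A : E →L[ℝ] F) : IsMoorePenrose A (pinv A) :=
  Classical.choose_spec (exists_isMoorePenrose A)

/-- The operator `K* (K K*)† K`. -/
def rowProj (K : E →L[ℝ] F) : E →L[ℝ] E :=
  (ContinuousLinearMap.adjoint K) ∘L (pinv (K ∘L ContinuousLinearMap.adjoint K)) ∘L K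

/-- `σ⁺_min(K)`: the minimum of `‖K X‖ / ‖K* (K K*)† K X‖` over all `X` for which the denominator
does not vanish (all norms Euclidean). -/
def sigmaMinPos (K : E →L[ℝ] F) : ℝ :=
  sInf {t : ℝ | ∃ X : E, rowProj K X ≠ 0 ∧ t = ‖K X‖ / ‖rowProj K X‖}

end MoorePenrose

/-! ### Bregman divergence, Fenchel conjugate, gradient sliding -/

section Sliding

variable {H : Type*} [NormedAddCommGroup H] [InnerProductSpace ℝ H]

/-- The Bregman divergence generated by `w`. -/
def bregman (w : H → ℝ) (x z : H) : ℝ := w x - w z - fderiv ℝ w z (x - z)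

/-- The divergence `D` generated by `w(x) = ‖x‖² / 2`. -/
def breg (x z : H) : ℝ := bregman (fun u : H => (1 / 2 : ℝ) * ‖u‖ ^ 2) x z

theorem breg_eq (x z : H) : breg x z = (1 / 2 : ℝ) * ‖x - z‖ ^ 2 := by
  have h : HasFDerivAt (fun u : H => (1 / 2 : ℝ) * ‖u‖ ^ 2)
      ((1 / 2 : ℝ) • (2 • (innerSL ℝ z))) z :=
    ((hasStrictFDerivAt_norm_sq z).hasFDerivAt).const_mul _
  unfold breg bregman
  rw [h.fderiv]
  have h2 : ‖x - z‖ ^ 2 = ‖x‖ ^ 2 - 2 * inner ℝ x z + ‖z‖ ^ 2 := norm_sub_sq_real x z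
  simp only [smul_apply, innerSL_apply_apply, smul_eq_mul, nsmul_eq_mul,
    inner_sub_right, real_inner_self_eq_norm_sq]
  rw [h2, real_inner_comm]
  push_cast
  ring

/-- The Fenchel conjugate of a real-valued function, with values in the extended reals. -/
def fenchelConj (R : H → ℝ) (y : H) : EReal :=
  ⨆ y' : H, ((inner ℝ y y' - R y' : ℝ) : EReal)

/-- `(out, outHat) = GS(φ, U, D, T, (η_i), w, (x_i), x⁰)`: the output of `T` steps of the generalized
gradient sliding procedure, with the subgradient oracle `g` of `φ` and the sequences
`lam`, `β`. -/
def IsGradientSliding {ι : Type*} [Fintype ι] (g : H → H) (U : Set H) (T : ℕ) (lam β : ℕ → ℝ)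
    (η : ι → ℝ) (w : H) (x : ι → H) (x0 : H) (out outHat : H) : Prop :=
  ∃ u : ℕ → H, u 0 = x0 ∧
    (∀ t ∈ Finset.Icc 1 T, u t ∈ U ∧
      IsMinOn (fun z => inner ℝ (w + g (u (t - 1))) z + ∑ i, η i * breg z (x i)
        + (∑ i, η i) * β t * breg z (u (t - 1))) U (u t)) ∧
    out = u T ∧
    outHat = (∑ t ∈ Finset.Icc 1 T, lam t)⁻¹ • ∑ t ∈ Finset.Icc 1 T, lam t • u t

/-- The choice `λ_t = t`. -/
def slidingLam (t : ℕ) : ℝ := t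

/-- The choice `β_t = (t + 1) μ / (2 η) + (t - 1) / 2`. -/
def slidingBeta (μ η : ℝ) (t : ℕ) : ℝ := ((t : ℝ) + 1) * μ / (2 * η) + ((t : ℝ) - 1) / 2

end Sliding

/-! ### The distributed problem -/

/-- The space `ℝ^d` with the Euclidean norm. -/
abbrev Vec (d : ℕ) := EuclideanSpace ℝ (Fin d)

/-- The lifted space `∏_{v ∈ V} ℝ^d`, `V = [m]`, with the Euclidean norm. -/
abbrev Lifted (m d : ℕ) := PiLp 2 (fun _ : Fin m => Vec d)

/-- The product of the dual spaces `ℝ^{n_s}`, `s ∈ [S]`, with the Euclidean norm. -/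
abbrev DualSpace {S : ℕ} (n : Fin S → ℕ) := PiLp 2 (fun s => Vec (n s))

/-- The constant family `(x)_{v ∈ V}`. -/
def diag (m : ℕ) {d : ℕ} (x : Vec d) : Lifted m d := WithLp.toLp 2 (fun _ => x)

/-- The consensus projection `Π`, `Π(X)_v = m⁻¹ ∑_{v'} x_{v'}`. -/
def consensus {m d : ℕ} (X : Lifted m d) : Lifted m d :=
  diag m ((m : ℝ)⁻¹ • ∑ v, X v)

/-- The data of a distributed problem: feasible set, local objectives, their subgradient oracles
`f'_v`, the constants `μ_f` and `M_f`, the blocks `K_s`, and the updating rates `r_s`. -/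
structure Problem (m d S : ℕ) (n : Fin S → ℕ) where
  X : Set (Vec d)
  f : Fin m → Vec d → ℝ
  f' : Fin m → Vec d → Vec d
  μ : ℝ
  M : ℝ
  K : ∀ s, Lifted m d →L[ℝ] Vec (n s)
  r : Fin S → ℕ

namespace Problem

variable {m d S : ℕ} {n : Fin S → ℕ} (P : Problem m d S n)

/-- The lifted feasible set. -/
def lifted : Set (Lifted m d) := {Z | ∀ v, Z v ∈ P.X}

/-- The lifted objective `F(X) = ∑_v f_v(x_v)`. -/
def F (Z : Lifted m d) : ℝ := ∑ v, P.f v (Z v)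

/-- The stacked operator `K`, `(K X)_s = K_s X`. -/
def stacked : Lifted m d →L[ℝ] DualSpace n :=
  (PiLp.continuousLinearEquiv 2 ℝ (fun s => Vec (n s))).symm.toContinuousLinearMap ∘L
    ContinuousLinearMap.pi P.K

/-- `K X = 0` exactly when all components of `X` agree. -/
def KernelCondition : Prop :=
  ∀ Z : Lifted m d, P.stacked Z = 0 ↔ ∀ v v', Z v = Z v'

/-- `(μ/2)‖x - x'‖² ≤ f_v(x) - f_v(x') - ⟨f'_v(x'), x - x'⟩ ≤ M ‖x - x'‖` on the feasible set. -/
def GrowthCondition : Prop :=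
  ∀ v, ∀ x ∈ P.X, ∀ x' ∈ P.X,
    P.μ / 2 * ‖x - x'‖ ^ 2 ≤ P.f v x - P.f v x' - inner ℝ (P.f' v x') (x - x') ∧
    P.f v x - P.f v x' - inner ℝ (P.f' v x') (x - x') ≤ P.M * ‖x - x'‖

/-- `G` is a subgradient oracle of the lifted objective: `(G X)_v ∈ ∂f_v(x_v)`. -/
def IsSubgradientOracle (G : Lifted m d → Lifted m d) : Prop :=
  ∀ Z ∈ P.lifted, ∀ v, ∀ x ∈ P.X, P.f v (Z v) + inner ℝ (G Z v) (x - Z v) ≤ P.f v x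

/-- `{f_v}` is `a`-similar. -/
def IsSimilar (a : ℝ) : Prop :=
  ∃ G, P.IsSubgradientOracle G ∧
    ∀ Z ∈ P.lifted, P.stacked Z = 0 → ‖G Z - consensus (G Z)‖ ≤ a

/-- `{f_v}` is `{(a_s, K_s)}`-similar; this includes the orthogonality of the blocks. -/
def IsBlockSimilar (a : Fin S → ℝ) : Prop :=
  (∀ s s', s ≠ s' → P.K s ∘L ContinuousLinearMap.adjoint (P.K s') = 0) ∧
  ∃ G, P.IsSubgradientOracle G ∧
    ∀ s, ∀ Z ∈ P.lifted, P.stacked Z = 0 → ‖rowProj (P.K s) (G Z)‖ ≤ a s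

/-- `Z` is an `(ε, δ)`-solution; `xs` is a minimizer of `∑_v f_v`. -/
def IsSolution (xs : Vec d) (ε δ : ℝ) (Z : Lifted m d) : Prop :=
  Z ∈ P.lifted ∧ P.F Z ≤ P.F (diag m xs) + ε ∧ ‖Z - consensus Z‖ ≤ δ

/-! ### Parameters of the accelerated method -/

/-- The distribution `ρ_s = ‖K_s‖ / ∑_{s'} ‖K_{s'}‖`. -/
def normWeights (s : Fin S) : ℝ := ‖P.K s‖ / ∑ s', ‖P.K s'‖

/-- The distribution `ρ_s = ‖K_s‖ c_s / ∑_{s'} ‖K_{s'}‖ c_{s'}`. -/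
def blockWeights (c : Fin S → ℝ) (s : Fin S) : ℝ := ‖P.K s‖ * c s / ∑ s', ‖P.K s'‖ * c s'

/-- `σ⁺_min(K)` of the stacked operator. -/
def sigma : ℝ := sigmaMinPos P.stacked

/-- `σ⁺_min(K_s)`. -/
def sigmaBlock (s : Fin S) : ℝ := sigmaMinPos (P.K s)

/-- The moments `∑_s ρ_s r_s^j` of the rates. -/
def moment (ρ : Fin S → ℝ) (j : ℕ) : ℝ := ∑ s, ρ s * (P.r s : ℝ) ^ j

/-- `A = √(r³/r̄³ + 7 (r²/r̄²)²) A₁ + A₀`, with `r³`, `r²`, `r̄` the moments of the rates. -/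
def rateConst (ρ : Fin S → ℝ) (A₁ A₀ : ℝ) : ℝ :=
  √(P.moment ρ 3 / P.moment ρ 1 ^ 3 + 7 * (P.moment ρ 2 / P.moment ρ 1 ^ 2) ^ 2) * A₁ + A₀

/-- The threshold `2 r̄ A / √(μ ε)` for the number of iterations. -/
def iterBound (ρ : Fin S → ℝ) (A₁ A₀ ε : ℝ) : ℝ :=
  2 * P.moment ρ 1 * P.rateConst ρ A₁ A₀ / √(P.μ * ε)

/-- `θ_k = k + 2 r²/r̄`. -/
def theta (ρ : Fin S → ℝ) (k : ℤ) : ℝ := k + 2 * (P.moment ρ 2 / P.moment ρ 1)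

/-- `η_k = (μ / (2 r̄)) (k + r²/r̄)`. -/
def eta (ρ : Fin S → ℝ) (k : ℕ) : ℝ :=
  P.μ / (2 * P.moment ρ 1) * (k + P.moment ρ 2 / P.moment ρ 1)

/-- `τ_s = (‖K_s‖² / ρ_s) (4 r_s r̄ / μ)`. -/
def tau (ρ : Fin S → ℝ) (s : Fin S) : ℝ :=
  ‖P.K s‖ ^ 2 / ρ s * (4 * P.r s * P.moment ρ 1 / P.μ)

/-- `∑_{k'} θ_{k'}` over the `i`-th dual period `r_s i ≤ k' < r_s i + r_s` of block `s`. -/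
def thetaSum (ρ : Fin S → ℝ) (s : Fin S) (i : ℕ) : ℝ :=
  ∑ k ∈ Finset.Ico ((P.r s : ℤ) * i) ((P.r s : ℤ) * i + P.r s), P.theta ρ k

/-- The multi-timescale extrapolation of block `s` at local time `i` (with `α = 1`). -/
def extrapolation (ρ : Fin S → ℝ) (Z Zhat : ℤ → Lifted m d) (s : Fin S) (i : ℕ) : Lifted m d :=
  (∑ k ∈ Finset.Ico ((P.r s : ℤ) * i - P.r s) ((P.r s : ℤ) * i),
    P.theta ρ k • (Zhat k - Z (k - P.r s))) +
  ∑ k ∈ Finset.Ico ((P.r s : ℤ) * i - P.r s) ((P.r s : ℤ) * i), P.theta ρ (k + P.r s) • Z k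

/-- The `v`-component of `K* Ȳ^k`, where `ȳ_s^k = y_s^{⌊k / r_s⌋}`. -/
def dualForce (y : ∀ s, ℤ → Vec (n s)) (k : ℕ) (v : Fin m) : Vec d :=
  (∑ s, ContinuousLinearMap.adjoint (P.K s) (y s ((k / P.r s : ℕ) : ℤ))) v

/-- Every agent `v` computes `x_v^{init}` by gradient sliding on its own objective, started at
`x0 v`, with `ε₀ = a² / μ`, `η = (ε₀ / 2) / (m Dx)`, and `T0 ≥ 8 M² m / (ε₀ μ)` steps, where
`Dx` bounds the divergence from `x0 v` on the feasible set. -/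
structure IsLocalInit (a Dx : ℝ) (T0 : ℕ) (x0 zinit : Lifted m d) : Prop where
  start_mem : x0 ∈ P.lifted
  Dx_pos : 0 < Dx
  start_bound : ∀ v, ∀ x ∈ P.X, breg x (x0 v) ≤ Dx
  steps : 8 * P.M ^ 2 * m / (a ^ 2 / P.μ * P.μ) ≤ T0
  sliding : ∀ v, ∃ u : Vec d,
    IsGradientSliding (P.f' v) P.X T0 slidingLam
      (slidingBeta P.μ (a ^ 2 / P.μ / 2 / (m * Dx))) (fun _ : Unit => a ^ 2 / P.μ / 2 / (m * Dx))
      0 (fun _ => x0 v) (x0 v) u (zinit v)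

/-- A run of the distributed accelerated multi-timescale method over the global times
`k = 0, …, N`, with distribution `ρ`, penalties `R_s`, and `T` gradient sliding steps of every
agent at every global time. The primal sequences are indexed by global time and `y s` by the local
time of block `s`; negative times carry the initial values. -/
structure IsRun (ρ : Fin S → ℝ) (R : ∀ s, Vec (n s) → ℝ) (N T : ℕ) (zinit : Lifted m d)
    (Z Zhat : ℤ → Lifted m d) (y : ∀ s, ℤ → Vec (n s)) : Prop where
  init_Z : ∀ k < 0, Z k = zinit
  init_Zhat : ∀ k < 0, Zhat k = zinit
  init_y : ∀ s, ∀ i < 0, y s i = 0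
  dual : ∀ s, ∀ i : ℕ, P.r s * i ≤ N →
    IsMinOn (fun u : Vec (n s) =>
      ((inner ℝ (-((P.thetaSum ρ s i)⁻¹ • P.K s (P.extrapolation ρ Z Zhat s i))) u : ℝ) : EReal)
        + fenchelConj (R s) u
        + ((P.tau ρ s / P.thetaSum ρ s i * breg u (y s ((i : ℤ) - 1)) : ℝ) : EReal))
      Set.univ (y s i)
  primal : ∀ k : ℕ, k ≤ N → ∀ v,
    IsGradientSliding (P.f' v) P.X T slidingLam (slidingBeta P.μ (P.eta ρ k))
      (fun s => P.eta ρ k * ρ s) (P.dualForce y k v) (fun s => Z ((k : ℤ) - P.r s) v)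
      (Z ((k : ℤ) - 1) v) (Z k v) (Zhat k v)

/-- The horizon `N` is compatible with the rates: `N + 1 = r_s N_s` for all `s`. -/
def Admissible (N : ℕ) : Prop := ∀ s, P.r s ∣ N + 1

/-- `D₁ = μ² (r²/r̄)² D₀ / (2 m M²)` with `D₀ = 4 a² / μ²`; the lifted objective has the
constants `μ` and `√m M`. -/
def stepConst (ρ : Fin S → ℝ) (a : ℝ) : ℝ :=
  P.μ ^ 2 * (P.moment ρ 2 / P.moment ρ 1) ^ 2 / (2 * (√m * P.M) ^ 2) * (4 * a ^ 2 / P.μ ^ 2)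

/-- The requirement `T / N ≥ max (5 / √D₁) (64 r̄ / D₁)` on the number of gradient sliding
steps. -/
def EnoughSteps (ρ : Fin S → ℝ) (a : ℝ) (N T : ℕ) : Prop :=
  N * max (5 / √(P.stepConst ρ a)) (64 * P.moment ρ 1 / P.stepConst ρ a) ≤ T

/-- `Zhat` is the sequence `X̂^k` produced by a run over an admissible horizon `N`, from the local
gradient sliding initialization with similarity constant `a`. -/
def IsIterates (a : ℝ) (ρ : Fin S → ℝ) (R : ∀ s, Vec (n s) → ℝ) (N : ℕ)
    (Zhat : ℤ → Lifted m d) : Prop :=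
  P.Admissible N ∧ ∃ (T T0 : ℕ) (Dx : ℝ) (x0 zinit : Lifted m d) (Z : ℤ → Lifted m d)
    (y : ∀ s, ℤ → Vec (n s)),
    P.EnoughSteps ρ a N T ∧ P.IsLocalInit a Dx T0 x0 zinit ∧ P.IsRun ρ R N T zinit Z Zhat y

/-- The `θ`-weighted average of `X̂^0, …, X̂^N`. -/
def average (ρ : Fin S → ℝ) (N : ℕ) (Zhat : ℤ → Lifted m d) : Lifted m d :=
  (∑ k ∈ Finset.range (N + 1), P.theta ρ k)⁻¹ •
    ∑ k ∈ Finset.range (N + 1), P.theta ρ k • Zhat k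

/-- The number of communication rounds: the global times `k ≤ N` at which at least one dual block
is updated (`r_s ∣ k` for some `s`). -/
def commRounds (N : ℕ) : ℕ := by
  classical exact ((Finset.range (N + 1)).filter fun k => ∃ s, P.r s ∣ k).card

/-- Up to an additive constant that depends on the rates only, `B` communication rounds suffice to
reach an admissible horizon `N ≥ B`. -/
def RoundsAtMost (B : ℝ) : Prop :=
  ∃ N, P.Admissible N ∧ B ≤ N ∧ (P.commRounds N : ℝ) ≤ B + 1 + Finset.univ.lcm P.r

end Problem

end AMT

end

/-! The scheme is an inexact primal-dual method for the saddle function F(X) + ∑ (⟨K_s X, y_s⟩ -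
R_s*(y_s)). Since R_s = c_s‖·‖, the conjugate R_s* is the indicator of the ball of radius c_s. All
four cases follow from one penalized estimate, `IsIterates.penalized_le`: F(X̄) + ∑ c_s‖K_s X̄‖ ≤
F(X*) + ε for the averaged iterate X̄.

Two families of inequalities, weighted by θ_k, are added to obtain it. Gradient sliding solves each
primal subproblem up to a small error (`IsGradientSliding.gap_le`, lifted in `IsRun.primal_le`). A
dual block updates once per period with an extrapolated direction. The extrapolation makes the
pairing errors telescope, leaving ‖K_s B‖²/(2τ_s), where B is the weighted sum of X̂^k - X^{k-r_s}
over a period (`sum_dual_le`). The choice of τ_s lets the primal terms θ_k η_k ρ_s D(X̂^k,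
X^{k-r_s}) absorb this residue (`norm_map_periodDiff_le`). The remaining distances to X* telescope
across different delays r_s because ∑ ρ_s θ_{k+r_s} η_{k+r_s} = θ_k(μ + η_k) (`sum_proxWeight_add`).

What is left is O(1): ∑ τ_s c_s²/2, the initial distance times the first prox weights, and the
sliding errors. Similarity and strong convexity bound the initial distance by 4a²/μ²
(`IsSimilar.breg_diag_le`), and the number of sliding steps bounds the errors
(`IsRegular.sum_slidingErr_le`). Division by ∑ θ_k ≥ N²/2 gives the rate.

To pass from penalty to solution, similarity bounds F(ΠX) - F(X) by a multiple of the consensus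
violation, and σ⁺_min bounds that violation by ‖K X‖ or by the ‖K_s X‖. The penalties therefore
dominate the possible gain from leaving consensus. -/

namespace AMT

/-! ### The operator K*(KK*)†K as orthogonal projection onto (ker K)ᗮ, and σ⁺_min. -/

section RowProj

variable {E F : Type*} [NormedAddCommGroup E] [InnerProductSpace ℝ E]
  [NormedAddCommGroup F] [InnerProductSpace ℝ F]
  [FiniteDimensional ℝ E] [FiniteDimensional ℝ F]

theorem rowProj_apply (K : E →L[ℝ] F) (x : E) :
    rowProj K x = ContinuousLinearMap.adjoint K
      (pinv (K ∘L ContinuousLinearMap.adjoint K) (K x)) := rfl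

theorem inner_rowProj_eq_zero (K : E →L[ℝ] F) {z : E} (hz : K z = 0) (x : E) :
    inner ℝ z (rowProj K x) = 0 := by
  rw [rowProj_apply, ContinuousLinearMap.adjoint_inner_right, hz, inner_zero_left]

/-- For the symmetric operator A = KK*, the Penrose equations make A A† y - y lie in ker A = ker K*.
Hence K* A A† = K*, and taking adjoints gives A A† K = K. -/
theorem map_rowProj (K : E →L[ℝ] F) (x : E) : K (rowProj K x) = K x := by
  set A := K ∘L ContinuousLinearMap.adjoint K with hA
  have hAapp : ∀ y, A y = K (ContinuousLinearMap.adjoint K y) := fun y => rfl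
  have hp := isMoorePenrose_pinv A
  have hsymm : ∀ y z, inner ℝ (A y) z = inner ℝ y (A z) := by
    intro y z
    rw [hAapp, hAapp, ← ContinuousLinearMap.adjoint_inner_right]
    exact ContinuousLinearMap.adjoint_inner_left _ _ _
  have h1 : ∀ y, A (A (pinv A y)) = A y := by
    intro y
    refine ext_inner_right ℝ fun z => ?_
    rw [hsymm, hp.symm_left, hp.mul_mul_left, hsymm]
  have h2 : ∀ y, ContinuousLinearMap.adjoint K (A (pinv A y)) =
      ContinuousLinearMap.adjoint K y := by
    intro y
    rw [← sub_eq_zero, ← map_sub, ← inner_self_eq_zero (𝕜 := ℝ),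
      ContinuousLinearMap.adjoint_inner_left, ← hAapp, map_sub, h1, sub_self, inner_zero_right]
  change A (pinv A (K x)) = K x
  refine ext_inner_right ℝ fun z => ?_
  rw [hp.symm_left, ← ContinuousLinearMap.adjoint_inner_right, h2,
    ContinuousLinearMap.adjoint_inner_right]

theorem inner_rowProj_right (K : E →L[ℝ] F) (x y : E) :
    inner ℝ x (rowProj K y) = inner ℝ (rowProj K x) (rowProj K y) := by
  have h : K (x - rowProj K x) = 0 := by rw [map_sub, map_rowProj, sub_self]
  have := inner_rowProj_eq_zero K h y
  rw [inner_sub_left] at this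
  linarith

omit [FiniteDimensional ℝ E] [FiniteDimensional ℝ F] in
/-- The only vector orthogonal to the kernel that agrees with `x` modulo the kernel. -/
theorem eq_of_sub_mem_ker (K : E →L[ℝ] F) {x p q : E} (hp : K p = K x) (hq : K q = K x)
    (hp' : ∀ z, K z = 0 → inner ℝ z p = 0) (hq' : ∀ z, K z = 0 → inner ℝ z q = 0) : p = q := by
  have h : K (p - q) = 0 := by rw [map_sub, hp, hq, sub_self]
  rw [← sub_eq_zero, ← inner_self_eq_zero (𝕜 := ℝ), inner_sub_right, hp' _ h, hq' _ h, sub_self]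

theorem sigmaMinPos_mul_le (K : E →L[ℝ] F) (x : E) : sigmaMinPos K * ‖rowProj K x‖ ≤ ‖K x‖ := by
  by_cases h : rowProj K x = 0
  · rw [h, norm_zero, mul_zero]
    exact norm_nonneg _
  · rw [← le_div_iff₀ (norm_pos_iff.2 h)]
    refine csInf_le ⟨0, ?_⟩ ⟨x, h, rfl⟩
    rintro t ⟨X, -, rfl⟩
    positivity

/-- The projection factors as L ∘ K with L = K*(KK*)†, so every admissible ratio is at least 1/‖L‖.
A nonzero K makes the set of ratios nonempty, so its `sInf` is not the default value 0. -/
theorem sigmaMinPos_pos {K : E →L[ℝ] F} (hK : K ≠ 0) : 0 < sigmaMinPos K := by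
  set L := (ContinuousLinearMap.adjoint K) ∘L (pinv (K ∘L ContinuousLinearMap.adjoint K)) with hL
  have hLK : ∀ x, ‖rowProj K x‖ ≤ ‖L‖ * ‖K x‖ := fun x => L.le_opNorm (K x)
  obtain ⟨x, hx⟩ : ∃ x, K x ≠ 0 := by
    by_contra! h
    exact hK (ContinuousLinearMap.ext h)
  have hx' : rowProj K x ≠ 0 := by
    intro h
    apply hx
    rw [← map_rowProj, h, map_zero]
  have hLpos : 0 < ‖L‖ := by
    by_contra! h
    have h0 : ‖L‖ = 0 := le_antisymm h (norm_nonneg _)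
    have := hLK x
    rw [h0, zero_mul] at this
    exact hx' (norm_le_zero_iff.1 this)
  refine lt_of_lt_of_le (inv_pos.2 hLpos) (le_csInf ⟨_, x, hx', rfl⟩ ?_)
  rintro t ⟨X, hX, rfl⟩
  rw [le_div_iff₀ (norm_pos_iff.2 hX), inv_mul_le_iff₀ hLpos]
  exact hLK X

end RowProj

/-! ### The averaging map as an orthogonal projection. -/

section Consensus

variable {m d : ℕ}

theorem consensus_apply (Z : Lifted m d) (v : Fin m) :
    consensus Z v = (m : ℝ)⁻¹ • ∑ v', Z v' := rfl

theorem inner_sub_consensus (hm : 0 < m) {W : Lifted m d} (hW : ∀ v v', W v = W v')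
    (Z : Lifted m d) : inner ℝ W (Z - consensus Z) = 0 := by
  have hm' : (m : ℝ) ≠ 0 := by positivity
  rw [PiLp.inner_apply]
  have h : ∀ v, inner ℝ (W v) ((Z - consensus Z) v) =
      inner ℝ (W ⟨0, hm⟩) (Z v - (m : ℝ)⁻¹ • ∑ v', Z v') := by
    intro v
    rw [hW v ⟨0, hm⟩]
    rfl
  simp_rw [h]
  rw [← inner_sum, Finset.sum_sub_distrib, Finset.sum_const, Finset.card_univ, Fintype.card_fin,
    ← Nat.cast_smul_eq_nsmul ℝ, smul_inv_smul₀ hm', sub_self, inner_zero_right]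

theorem norm_sub_sq_eq_add_consensus (hm : 0 < m) {W : Lifted m d} (hW : ∀ v v', W v = W v')
    (Z : Lifted m d) :
    ‖Z - W‖ ^ 2 = ‖Z - consensus Z‖ ^ 2 + ‖consensus Z - W‖ ^ 2 := by
  have h := inner_sub_consensus hm (W := consensus Z - W)
    (fun v v' => congrArg (consensus Z v - ·) (hW v v')) Z
  have h2 : Z - W = (Z - consensus Z) + (consensus Z - W) := by abel
  rw [h2, norm_add_sq_real, real_inner_comm, h]
  ring

end Consensus

/-! ### The blocks K_s, the stacked operator and the consensus projection. -/

namespace Problem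

variable {m d S : ℕ} {n : Fin S → ℕ} (P : Problem m d S n)

theorem stacked_apply (Z : Lifted m d) (s : Fin S) : P.stacked Z s = P.K s Z := rfl

theorem stacked_eq_zero_iff (Z : Lifted m d) : P.stacked Z = 0 ↔ ∀ s, P.K s Z = 0 := by
  refine ⟨fun h s => ?_, fun h => ?_⟩
  · rw [← stacked_apply, h]; rfl
  · ext1 s
    exact h s

variable {P}

theorem pos_of_block_ne_zero (hS : 0 < S) (hK : ∀ s, P.K s ≠ 0) : 0 < m := by
  rcases Nat.eq_zero_or_pos m with rfl | h
  · refine absurd ?_ (hK ⟨0, hS⟩)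
    ext1 Z
    rw [Subsingleton.elim Z 0, map_zero, map_zero]
  · exact h

theorem stacked_ne_zero (hS : 0 < S) (hK : ∀ s, P.K s ≠ 0) : P.stacked ≠ 0 := by
  intro h
  apply hK ⟨0, hS⟩
  ext1 Z
  rw [← stacked_apply, h]; rfl

theorem KernelCondition.stacked_consensus (h : P.KernelCondition) (Z : Lifted m d) :
    P.stacked (consensus Z) = 0 :=
  (h _).2 fun _ _ => rfl

/-- The kernel of the stacked operator is the consensus subspace, so both sides are the
representative of Z modulo that kernel which is orthogonal to it. -/
theorem KernelCondition.rowProj_stacked (h : P.KernelCondition) (hm : 0 < m) (Z : Lifted m d) :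
    rowProj P.stacked Z = Z - consensus Z := by
  refine eq_of_sub_mem_ker P.stacked (x := Z) (map_rowProj _ _) ?_
    (fun z hz => inner_rowProj_eq_zero _ hz _)
    (fun z hz => inner_sub_consensus hm ((h z).1 hz) Z)
  rw [map_sub, h.stacked_consensus, sub_zero]

/-- By orthogonality, K_s kills the range of K_{s'}* for s' ≠ s, so only the s-th summand survives
under K_s. -/
theorem KernelCondition.sum_rowProj (h : P.KernelCondition) (hm : 0 < m)
    (horth : ∀ s s', s ≠ s' → P.K s ∘L ContinuousLinearMap.adjoint (P.K s') = 0)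
    (Z : Lifted m d) : ∑ s, rowProj (P.K s) Z = Z - consensus Z := by
  rw [← h.rowProj_stacked hm]
  refine eq_of_sub_mem_ker P.stacked (x := Z) ?_ (map_rowProj _ _) ?_
    (fun z hz => inner_rowProj_eq_zero _ hz _)
  · rw [← sub_eq_zero, ← map_sub, stacked_eq_zero_iff]
    intro s
    rw [map_sub, map_sum, Finset.sum_eq_single s, map_rowProj, sub_self]
    · intro s' _ hs
      rw [rowProj_apply]
      exact DFunLike.congr_fun (horth s s' hs.symm) _
    · simp
  · intro z hz
    rw [inner_sum]
    exact Finset.sum_eq_zero fun s _ =>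
      inner_rowProj_eq_zero _ ((stacked_eq_zero_iff P z).1 hz s) _

theorem inner_rowProj_rowProj
    (horth : ∀ s s', s ≠ s' → P.K s ∘L ContinuousLinearMap.adjoint (P.K s') = 0)
    {s s' : Fin S} (hs : s ≠ s') (Z W : Lifted m d) :
    inner ℝ (rowProj (P.K s) Z) (rowProj (P.K s') W) = 0 := by
  refine inner_rowProj_eq_zero _ ?_ _
  rw [rowProj_apply]
  exact DFunLike.congr_fun (horth s' s hs.symm) _

theorem KernelCondition.norm_sub_consensus_sq (h : P.KernelCondition) (hm : 0 < m)
    (horth : ∀ s s', s ≠ s' → P.K s ∘L ContinuousLinearMap.adjoint (P.K s') = 0)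
    (Z : Lifted m d) : ‖Z - consensus Z‖ ^ 2 = ∑ s, ‖rowProj (P.K s) Z‖ ^ 2 := by
  rw [← h.sum_rowProj hm horth, ← real_inner_self_eq_norm_sq, sum_inner]
  refine Finset.sum_congr rfl fun s _ => ?_
  rw [inner_sum, Finset.sum_eq_single s, real_inner_self_eq_norm_sq]
  · intro s' _ hs
    exact inner_rowProj_rowProj horth hs.symm _ _
  · simp

theorem IsBlockSimilar.isSimilar (h : P.KernelCondition) (hm : 0 < m) {a : Fin S → ℝ}
    (ha : P.IsBlockSimilar a) : P.IsSimilar √(∑ s, a s ^ 2) := by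
  obtain ⟨horth, G, hG, hGa⟩ := ha
  refine ⟨G, hG, fun Z hZ hKZ => Real.le_sqrt_of_sq_le ?_⟩
  rw [h.norm_sub_consensus_sq hm horth]
  exact Finset.sum_le_sum fun s _ => pow_le_pow_left₀ (norm_nonneg _) (hGa s Z hZ hKZ) 2

theorem norm_stacked_le (Z : Lifted m d) : ‖P.stacked Z‖ ≤ ∑ s, ‖P.K s Z‖ := by
  rw [PiLp.norm_eq_of_L2]
  refine Real.sqrt_le_iff.2 ⟨Finset.sum_nonneg fun s _ => norm_nonneg _, ?_⟩
  exact Finset.sum_sq_le_sq_sum_of_nonneg fun s _ => norm_nonneg _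

end Problem

/-! ### Strong convexity and the three-point inequality. -/

section StrongConvexity

variable {H : Type*} [NormedAddCommGroup H] [InnerProductSpace ℝ H]
  {U : Set H} {C C' : ℝ} {q q' : H → ℝ}

theorem strongConvexOn_add (h : StrongConvexOn U C q) (h' : StrongConvexOn U C' q') :
    StrongConvexOn U (C + C') (fun z => q z + q' z) := by
  refine ⟨h.1, fun x hx y hy a b ha hb hab => ?_⟩
  have h1 := h.2 hx hy ha hb hab
  have h2 := h'.2 hx hy ha hb hab
  simp only [smul_eq_mul] at h1 h2 ⊢
  nlinarith [h1, h2]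

theorem strongConvexOn_const_mul (h : StrongConvexOn U C q) {c : ℝ} (hc : 0 ≤ c) :
    StrongConvexOn U (c * C) (fun z => c * q z) := by
  refine ⟨h.1, fun x hx y hy a b ha hb hab => ?_⟩
  have h1 := mul_le_mul_of_nonneg_left (h.2 hx hy ha hb hab) hc
  simp only [smul_eq_mul] at h1 ⊢
  linarith

theorem strongConvexOn_sum (hU : Convex ℝ U) {ι : Type*} (s : Finset ι) {c : ι → ℝ}
    {p : ι → H → ℝ} (h : ∀ i ∈ s, StrongConvexOn U (c i) (p i)) :
    StrongConvexOn U (∑ i ∈ s, c i) (fun z => ∑ i ∈ s, p i z) := by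
  classical
  induction s using Finset.induction_on with
  | empty =>
    simp only [Finset.sum_empty, strongConvexOn_zero]
    exact convexOn_const 0 hU
  | insert i s hi ih =>
    simp only [Finset.sum_insert hi]
    exact strongConvexOn_add (h i (Finset.mem_insert_self i s))
      (ih fun j hj => h j (Finset.mem_insert_of_mem hj))

theorem strongConvexOn_inner (hU : Convex ℝ U) (g : H) :
    StrongConvexOn U 0 (fun z => inner ℝ g z) := by
  rw [strongConvexOn_zero]
  exact (innerSL ℝ g).toLinearMap.convexOn hU

theorem strongConvexOn_breg (hU : Convex ℝ U) (p : H) :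
    StrongConvexOn U 1 (fun z => breg z p) := by
  refine ⟨hU, fun x _ y _ a b _ _ hab => le_of_eq ?_⟩
  have h1 : a • x + b • y - p = a • (x - p) + b • (y - p) := by
    have : p = (a + b) • p := by rw [hab, one_smul]
    nth_rewrite 1 [this]
    module
  have h2 : x - y = (x - p) - (y - p) := by abel
  simp only [breg_eq, smul_eq_mul]
  rw [h1, h2, norm_add_sq_real, norm_sub_sq_real (x - p), norm_smul, norm_smul, mul_pow, mul_pow,
    inner_smul_left, inner_smul_right]
  simp only [Real.norm_eq_abs, sq_abs, conj_trivial]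
  obtain rfl : b = 1 - a := by linarith
  ring

/-- Compare u with u + t(z - u), divide by t and let t be small. No differentiability is needed;
every prox step below is analysed through this inequality. -/
theorem add_sq_le_of_isMinOn (hq : StrongConvexOn U C q) {u z : H} (hu : u ∈ U)
    (hmin : IsMinOn q U u) (hz : z ∈ U) : q u + C / 2 * ‖z - u‖ ^ 2 ≤ q z := by
  have key : ∀ t : ℝ, 0 < t → t < 1 →
      q u + C / 2 * ‖z - u‖ ^ 2 - q z ≤ t * (C / 2 * ‖z - u‖ ^ 2) := by
    intro t ht ht1
    have h1 := hq.2 hz hu ht.le (sub_nonneg.2 ht1.le) (by ring)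
    have h2 := hmin (hq.1 hz hu ht.le (sub_nonneg.2 ht1.le) (by ring))
    simp only [Set.mem_ofPred_eq, smul_eq_mul] at h1 h2
    refine le_of_mul_le_mul_left ?_ ht
    nlinarith [h1, h2]
  have hqz : q u ≤ q z := hmin hz
  set X := C / 2 * ‖z - u‖ ^ 2
  by_contra! hlt
  rcases le_or_gt X 0 with hX | hX
  · have := key (1 / 2) (by norm_num) (by norm_num)
    linarith
  -- With gap = q u + X - q z > 0, this t turns `key` into gap ≤ gap/2. It is below 1 because q u ≤
  -- q z.
  · have h := key ((q u + X - q z) / (2 * X)) (by apply div_pos <;> linarith)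
      (by rw [div_lt_one (by linarith)]; linarith)
    have h' : (q u + X - q z) / (2 * X) * X = (q u + X - q z) / 2 := by field_simp
    linarith

/-- Lower growth by subgradients at every point gives strong convexity. -/
theorem strongConvexOn_of_subgradient (hU : Convex ℝ U) {g : H → H}
    (hg : ∀ x ∈ U, ∀ x' ∈ U, C / 2 * ‖x - x'‖ ^ 2 ≤ q x - q x' - inner ℝ (g x') (x - x')) :
    StrongConvexOn U C q := by
  refine ⟨hU, fun x hx y hy a b ha hb hab => ?_⟩
  have hp := hU hx hy ha hb hab
  set p := a • x + b • y with hpdef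
  have h1 := mul_le_mul_of_nonneg_left (hg x hx p hp) ha
  have h2 := mul_le_mul_of_nonneg_left (hg y hy p hp) hb
  have hx' : x - p = b • (x - y) := by
    rw [hpdef]
    obtain rfl : a = 1 - b := by linarith
    module
  have hy' : y - p = (-a) • (x - y) := by
    rw [hpdef]
    obtain rfl : b = 1 - a := by linarith
    module
  rw [hx', norm_smul, inner_smul_right, mul_pow, Real.norm_eq_abs, sq_abs] at h1
  rw [hy', norm_smul, inner_smul_right, mul_pow, Real.norm_eq_abs, sq_abs] at h2
  simp only [smul_eq_mul]
  obtain rfl : b = 1 - a := by linarith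
  nlinarith [h1, h2]

/-- Every subgradient of a strongly convex function satisfies the quadratic lower bound. -/
theorem subgradient_add_sq_le (hq : StrongConvexOn U C q) {g u z : H} (hu : u ∈ U)
    (hg : ∀ x ∈ U, q u + inner ℝ g (x - u) ≤ q x) (hz : z ∈ U) :
    q u + inner ℝ g (z - u) + C / 2 * ‖z - u‖ ^ 2 ≤ q z := by
  -- Subtracting the linear functional of the subgradient makes u a minimizer without changing the
  -- modulus.
  have h := add_sq_le_of_isMinOn (strongConvexOn_add hq (strongConvexOn_inner hq.1 (-g))) hu
    (fun x hx => ?_) hz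
  · simp only [inner_neg_left, add_zero] at h
    rw [inner_sub_right]
    linarith
  · have := hg x hx
    simp only [Set.mem_ofPred_eq, inner_neg_left]
    rw [inner_sub_right] at this
    linarith

end StrongConvexity

/-! ### Error analysis of gradient sliding. -/

section GradientSliding

variable {H : Type*} [NormedAddCommGroup H] [InnerProductSpace ℝ H]
  {ι : Type*} [Fintype ι] {U : Set H} {φ : H → ℝ} {g : H → H} {μ M : ℝ}

/-- The error of `T` steps of gradient sliding with total prox weight `e`. -/
noncomputable def slidingErr (μ M e : ℝ) (T : ℕ) : ℝ :=
  (∑ t ∈ Finset.Icc 1 T, slidingLam t)⁻¹ *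
    ∑ t ∈ Finset.Icc 1 T, (t : ℝ) * (M ^ 2 / ((t + 1) * μ + (t - 1) * e))

theorem sum_slidingLam (T : ℕ) : ∑ t ∈ Finset.Icc 1 T, slidingLam t = T * (T + 1) / 2 := by
  induction T with
  | zero => simp
  | succ T ih =>
    rw [Finset.sum_Icc_succ_top (by omega), ih, slidingLam]
    push_cast
    ring

/-- The prox part of each denominator is dropped, so the bound is uniform in e; it serves the
initialization. -/
theorem slidingErr_le (hμ : 0 < μ) {e : ℝ} (he : 0 < e) {T : ℕ} (hT : 1 ≤ T) :
    slidingErr μ M e T ≤ 2 * M ^ 2 / (T * μ) := by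
  have hT' : (0 : ℝ) < T := by exact_mod_cast hT
  have hsum : ∑ t ∈ Finset.Icc 1 T, (t : ℝ) * (M ^ 2 / ((t + 1) * μ + (t - 1) * e)) ≤
      T * (M ^ 2 / μ) := by
    have := Finset.sum_le_card_nsmul (Finset.Icc 1 T)
      (fun t : ℕ => (t : ℝ) * (M ^ 2 / ((t + 1) * μ + (t - 1) * e))) (M ^ 2 / μ) ?_
    · simpa using this
    · intro t ht
      have h1 : (1 : ℝ) ≤ t := by exact_mod_cast (Finset.mem_Icc.1 ht).1
      have h2 : 0 ≤ ((t : ℝ) - 1) * e := mul_nonneg (by linarith) he.le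
      have h3 : 0 < ((t : ℝ) + 1) * μ := by positivity
      rw [← mul_div_assoc, div_le_div_iff₀ (by linarith) hμ]
      have : (t : ℝ) * μ ≤ (t + 1) * μ + (t - 1) * e := by linarith
      nlinarith [mul_le_mul_of_nonneg_left this (sq_nonneg M)]
  rw [slidingErr, sum_slidingLam, inv_mul_le_iff₀ (by positivity)]
  refine hsum.trans ?_
  have : (T : ℝ) * (T + 1) / 2 * (2 * M ^ 2 / (T * μ)) = (T + 1) * (M ^ 2 / μ) := by
    field_simp
  rw [this]
  have : 0 ≤ M ^ 2 / μ := by positivity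
  nlinarith

/-- At t = 1 the prox part of the denominator vanishes, which costs M²/(2μ) once. For t ≥ 2 one has
t ≤ 2(t - 1), and each term is at most 2M²/e. -/
theorem slidingErr_le' (hμ : 0 < μ) {e : ℝ} (he : 0 < e) {T : ℕ} (hT : 1 ≤ T) :
    slidingErr μ M e T ≤ M ^ 2 / μ / T ^ 2 + 4 * M ^ 2 / (T * e) := by
  have hT' : (0 : ℝ) < T := by exact_mod_cast hT
  have hsum : ∑ t ∈ Finset.Icc 1 T, (t : ℝ) * (M ^ 2 / ((t + 1) * μ + (t - 1) * e)) ≤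
      M ^ 2 / (2 * μ) + T * (2 * M ^ 2 / e) := by
    rw [← Finset.insert_Icc_add_one_left_eq_Icc hT, Finset.sum_insert (by simp)]
    refine add_le_add (le_of_eq ?_) ?_
    · push_cast
      norm_num
    · have := Finset.sum_le_card_nsmul (Finset.Icc (1 + 1) T)
        (fun t : ℕ => (t : ℝ) * (M ^ 2 / ((t + 1) * μ + (t - 1) * e))) (2 * M ^ 2 / e) ?_
      · refine this.trans ?_
        rw [nsmul_eq_mul]
        refine mul_le_mul_of_nonneg_right ?_ (by positivity)
        rw [Nat.card_Icc]
        exact_mod_cast (by omega : T + 1 - (1 + 1) ≤ T)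
      · intro t ht
        have h1 : (2 : ℝ) ≤ t := by exact_mod_cast (Finset.mem_Icc.1 ht).1
        have h2 : 0 < ((t : ℝ) - 1) * e := mul_pos (by linarith) he
        have h3 : 0 < ((t : ℝ) + 1) * μ := by positivity
        rw [← mul_div_assoc, div_le_div_iff₀ (by linarith) he]
        have : (t : ℝ) * e ≤ 2 * ((t + 1) * μ + (t - 1) * e) := by nlinarith
        nlinarith [mul_le_mul_of_nonneg_left this (sq_nonneg M)]
  rw [slidingErr, sum_slidingLam, inv_mul_le_iff₀ (by positivity)]
  refine hsum.trans ?_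
  have h : (T : ℝ) * (T + 1) / 2 * (M ^ 2 / μ / T ^ 2 + 4 * M ^ 2 / (T * e)) =
      (M ^ 2 / (2 * μ) + T * (2 * M ^ 2 / e)) + (M ^ 2 / (2 * μ) / T + 2 * M ^ 2 / e) := by
    field_simp
    ring
  rw [h]
  have : 0 ≤ M ^ 2 / (2 * μ) / T + 2 * M ^ 2 / e := by positivity
  linarith

theorem IsGradientSliding.mem (hU : Convex ℝ U) {T : ℕ} (hT : 1 ≤ T) {β : ℕ → ℝ} {η : ι → ℝ}
    {w : H} {x : ι → H} {x0 out outHat : H}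
    (h : IsGradientSliding g U T slidingLam β η w x x0 out outHat) : out ∈ U ∧ outHat ∈ U := by
  obtain ⟨u, -, hu, rfl, rfl⟩ := h
  refine ⟨(hu T (by simp [hT])).1, ?_⟩
  refine hU.centerMass_mem (t := Finset.Icc 1 T) (w := slidingLam) (z := u) ?_ ?_
    fun t ht => (hu t ht).1
  · intro t _
    exact Nat.cast_nonneg t
  · have : (0 : ℝ) < T := by exact_mod_cast hT
    rw [sum_slidingLam]
    positivity

/-- The three-point inequality at u, combined with the upper growth bound between u and p and the
lower one between z and p. Young's inequality pays for M‖u - p‖ with b·D(u, p), and strong convexity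
of φ improves the coefficient of D(z, p) to b - μ. -/
theorem sliding_step (hφ : ∀ x ∈ U, ∀ x' ∈ U,
      μ / 2 * ‖x - x'‖ ^ 2 ≤ φ x - φ x' - inner ℝ (g x') (x - x') ∧
      φ x - φ x' - inner ℝ (g x') (x - x') ≤ M * ‖x - x'‖)
    (hU : Convex ℝ U) {η : ι → ℝ} (hη : ∀ i, 0 ≤ η i) {b : ℝ} (hb : 0 < b) {w : H} {x : ι → H}
    {p u z : H} (hp : p ∈ U) (hu : u ∈ U) (hz : z ∈ U)
    (hmin : IsMinOn (fun z => inner ℝ (w + g p) z + ∑ i, η i * breg z (x i) + b * breg z p) U u) :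
    inner ℝ w (u - z) + φ u - φ z + ∑ i, η i * breg u (x i) + (∑ i, η i + b) * breg z u ≤
      ∑ i, η i * breg z (x i) + (b - μ) * breg z p + M ^ 2 / (2 * b) := by
  have hconv : StrongConvexOn U (0 + ∑ i, η i * 1 + b * 1)
      (fun z => inner ℝ (w + g p) z + ∑ i, η i * breg z (x i) + b * breg z p) :=
    strongConvexOn_add (strongConvexOn_add (strongConvexOn_inner hU _)
      (strongConvexOn_sum hU _ fun i _ =>
        strongConvexOn_const_mul (strongConvexOn_breg hU (x i)) (hη i)))
      (strongConvexOn_const_mul (strongConvexOn_breg hU p) hb.le)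
  have h1 := add_sq_le_of_isMinOn hconv hu hmin hz
  simp only [mul_one, zero_add] at h1
  have h2 := (hφ u hu p hp).2
  have h3 := (hφ z hz p hp).1
  have hy : M * ‖u - p‖ ≤ b * breg u p + M ^ 2 / (2 * b) := by
    have h := sq_nonneg (b * ‖u - p‖ - M)
    have e : b * breg u p + M ^ 2 / (2 * b) - M * ‖u - p‖ =
        (b * ‖u - p‖ - M) ^ 2 / (2 * b) := by
      rw [breg_eq]
      field_simp
      ring
    have : 0 ≤ (b * ‖u - p‖ - M) ^ 2 / (2 * b) := by positivity
    linarith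
  have e1 : breg z u = 1 / 2 * ‖z - u‖ ^ 2 := breg_eq z u
  have e2 : breg z p = 1 / 2 * ‖z - p‖ ^ 2 := breg_eq z p
  rw [inner_add_left, inner_add_left] at h1
  rw [inner_sub_right] at h2 h3 ⊢
  rw [e1]
  have e3 : μ / 2 * ‖z - p‖ ^ 2 = μ * breg z p := by rw [e2]; ring
  linarith

theorem IsGradientSliding.gap_le (hφ : ∀ x ∈ U, ∀ x' ∈ U,
      μ / 2 * ‖x - x'‖ ^ 2 ≤ φ x - φ x' - inner ℝ (g x') (x - x') ∧
      φ x - φ x' - inner ℝ (g x') (x - x') ≤ M * ‖x - x'‖)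
    (hU : Convex ℝ U) (hμ : 0 < μ) {T : ℕ} (hT : 1 ≤ T) {η : ι → ℝ} (hη : ∀ i, 0 ≤ η i)
    {e : ℝ} (he : 0 < e) (hsum : ∑ i, η i = e) {w : H} {x : ι → H} {x0 out outHat z : H}
    (hx0 : x0 ∈ U) (hz : z ∈ U)
    (h : IsGradientSliding g U T slidingLam (slidingBeta μ e) η w x x0 out outHat) :
    inner ℝ w (outHat - z) + φ outHat - φ z + ∑ i, η i * breg outHat (x i)
        + (μ + e) * breg z out ≤
      ∑ i, η i * breg z (x i) + slidingErr μ M e T := by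
  have hT' : (0 : ℝ) < T := by exact_mod_cast hT
  obtain ⟨u, rfl, hu, rfl, rfl⟩ := h
  set ψ : H → ℝ := fun z => inner ℝ w z + φ z + ∑ i, η i * breg z (x i) with hψ
  have hsteps : ∀ k ≤ T, ∑ t ∈ Finset.Icc 1 k, (t : ℝ) * (ψ (u t) - ψ z)
      + k * (k + 1) / 2 * (μ + e) * breg z (u k) ≤
      ∑ t ∈ Finset.Icc 1 k, (t : ℝ) * (M ^ 2 / ((t + 1) * μ + (t - 1) * e)) := by
    intro k
    induction k with
    | zero => simp
    | succ k ih =>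
      intro hk
      have ih' := ih (by omega)
      rw [Finset.sum_Icc_succ_top (by omega), Finset.sum_Icc_succ_top (by omega)]
      have hmem : k + 1 ∈ Finset.Icc 1 T := by simp; omega
      have huk : u k ∈ U := by
        rcases Nat.eq_zero_or_pos k with rfl | hk0
        · exact hx0
        · exact (hu k (by simp; omega)).1
      -- For this b, b - μ = k(μ + e)/2 and e + b = (k + 2)(μ + e)/2. After multiplication by k + 1
      -- the two distance coefficients are consecutive values of k(k + 1)/2 · (μ + e), so the sum
      -- telescopes exactly.
      have hb : e * slidingBeta μ e (k + 1) = ((k + 2) * μ + k * e) / 2 := by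
        rw [slidingBeta]
        push_cast
        field_simp
        ring
      have hbpos : 0 < ((k + 2) * μ + k * e) / 2 := by positivity
      have hstep := sliding_step hφ hU hη hbpos (w := w) (x := x) huk (hu _ hmem).1 hz (by
        have := (hu _ hmem).2
        rwa [hsum, hb, Nat.add_sub_cancel] at this)
      rw [hsum, inner_sub_right] at hstep
      have hstep' := mul_le_mul_of_nonneg_left hstep (by positivity : (0 : ℝ) ≤ k + 1)
      have e1 : (((k + 1 : ℕ) : ℝ) + 1) * μ + (((k + 1 : ℕ) : ℝ) - 1) * e =
          2 * (((k + 2) * μ + k * e) / 2) := by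
        push_cast
        ring
      rw [e1]
      simp only [hψ] at ih' ⊢
      push_cast
      linarith
  have hconv : ConvexOn ℝ U ψ := by
    have h1 : StrongConvexOn U (0 + μ + ∑ i, η i * 1) ψ :=
      strongConvexOn_add (strongConvexOn_add (strongConvexOn_inner hU _)
        (strongConvexOn_of_subgradient hU fun x hx x' hx' => (hφ x hx x' hx').1))
        (strongConvexOn_sum hU _ fun i _ =>
          strongConvexOn_const_mul (strongConvexOn_breg hU (x i)) (hη i))
    rw [← strongConvexOn_zero]
    refine h1.mono ?_
    simp only [mul_one, hsum]
    linarith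
  have hpos : 0 < ∑ t ∈ Finset.Icc 1 T, slidingLam t := by
    rw [sum_slidingLam]
    positivity
  have hjensen := hconv.map_centerMass_le (t := Finset.Icc 1 T) (w := slidingLam) (p := u)
    (fun t _ => Nat.cast_nonneg t) hpos fun t ht => (hu t ht).1
  simp only [Finset.centerMass, smul_eq_mul, Function.comp_apply] at hjensen
  set uh := (∑ t ∈ Finset.Icc 1 T, slidingLam t)⁻¹ • ∑ t ∈ Finset.Icc 1 T, slidingLam t • u t
  have hfin := hsteps T le_rfl
  rw [← sum_slidingLam] at hfin
  set Λ := ∑ t ∈ Finset.Icc 1 T, slidingLam t with hΛ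
  have hsplit : ∑ t ∈ Finset.Icc 1 T, (t : ℝ) * (ψ (u t) - ψ z) =
      ∑ t ∈ Finset.Icc 1 T, slidingLam t * ψ (u t) - Λ * ψ z := by
    rw [hΛ, Finset.sum_mul, ← Finset.sum_sub_distrib]
    exact Finset.sum_congr rfl fun t _ => mul_sub _ _ _
  rw [hsplit] at hfin
  have hmul := mul_le_mul_of_nonneg_left hfin (inv_pos.2 hpos).le
  have e2 : Λ⁻¹ * (∑ t ∈ Finset.Icc 1 T, slidingLam t * ψ (u t) - Λ * ψ z
      + Λ * (μ + e) * breg z (u T)) =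
      Λ⁻¹ * ∑ t ∈ Finset.Icc 1 T, slidingLam t * ψ (u t) - ψ z + (μ + e) * breg z (u T) := by
    field_simp
  rw [e2] at hmul
  have hfinal : ψ uh - ψ z + (μ + e) * breg z (u T) ≤ slidingErr μ M e T := by
    rw [slidingErr]
    linarith
  simp only [hψ] at hfinal
  rw [inner_sub_right]
  linarith

end GradientSliding

/-! ### Dual prox steps over balls, with extrapolation. -/

section DualStep

variable {H : Type*} [NormedAddCommGroup H] [InnerProductSpace ℝ H]

theorem fenchelConj_norm_of_le {c : ℝ} {y : H} (hy : ‖y‖ ≤ c) :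
    fenchelConj (fun z : H => c * ‖z‖) y = 0 := by
  refine le_antisymm (iSup_le fun z => ?_) ?_
  · have h1 := real_inner_le_norm y z
    have h2 := mul_le_mul_of_nonneg_right hy (norm_nonneg z)
    exact_mod_cast (by linarith : inner ℝ y z - c * ‖z‖ ≤ 0)
  · refine le_trans ?_ (le_iSup _ (0 : H))
    simp

theorem fenchelConj_norm_of_lt {c : ℝ} (hc : 0 ≤ c) {y : H} (hy : c < ‖y‖) :
    fenchelConj (fun z : H => c * ‖z‖) y = ⊤ := by
  rw [EReal.eq_top_iff_forall_lt]
  intro b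
  have hpos : 0 < ‖y‖ := hc.trans_lt hy
  have hgap : 0 < ‖y‖ * (‖y‖ - c) := mul_pos hpos (sub_pos.2 hy)
  set t := (|b| + 1) / (‖y‖ * (‖y‖ - c)) with ht
  have ht0 : 0 ≤ t := by positivity
  refine lt_of_lt_of_le ?_ (le_iSup _ (t • y))
  beta_reduce
  rw [EReal.coe_lt_coe_iff, inner_smul_right, norm_smul, Real.norm_of_nonneg ht0,
    real_inner_self_eq_norm_sq]
  have h : t * ‖y‖ ^ 2 - c * (t * ‖y‖) = |b| + 1 := by
    rw [ht]
    field_simp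
    exact div_self (sub_pos.2 hy).ne'
  rw [h]
  linarith [le_abs_self b]

theorem dual_step {c τ Θ : ℝ} (hc : 0 ≤ c) (hτ : 0 ≤ τ) (hΘ : 0 < Θ) {w p y : H}
    (hmin : IsMinOn (fun u : H => ((inner ℝ (-(Θ⁻¹ • w)) u : ℝ) : EReal)
      + fenchelConj (fun z : H => c * ‖z‖) u + ((τ / Θ * breg u p : ℝ) : EReal)) Set.univ y)
    {z : H} (hz : ‖z‖ ≤ c) :
    inner ℝ w (z - y) + τ * breg y p + τ * breg z y ≤ τ * breg z p := by
  -- Outside the ball the objective is ⊤, whereas at 0 it is finite.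
  have hy : ‖y‖ ≤ c := by
    by_contra! hlt
    have h0 := isMinOn_iff.1 hmin 0 (Set.mem_univ _)
    rw [fenchelConj_norm_of_lt hc hlt, fenchelConj_norm_of_le (by simpa using hc),
      EReal.coe_add_top, EReal.top_add_coe, add_zero, ← EReal.coe_add] at h0
    exact absurd h0 (not_le.2 (EReal.coe_lt_top _))
  have hball : Convex ℝ (Metric.closedBall (0 : H) c) := convex_closedBall 0 c
  have hmin' : IsMinOn (fun u : H => inner ℝ (-(Θ⁻¹ • w)) u + τ / Θ * breg u p)
      (Metric.closedBall 0 c) y := by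
    refine isMinOn_iff.2 fun u hu => ?_
    have h0 := isMinOn_iff.1 hmin u (Set.mem_univ _)
    rw [fenchelConj_norm_of_le hy, fenchelConj_norm_of_le (mem_closedBall_zero_iff.1 hu),
      add_zero, add_zero, ← EReal.coe_add, ← EReal.coe_add, EReal.coe_le_coe_iff] at h0
    exact h0
  have h := add_sq_le_of_isMinOn (strongConvexOn_add (strongConvexOn_inner hball _)
    (strongConvexOn_const_mul (strongConvexOn_breg hball p) (div_nonneg hτ hΘ.le)))
    (mem_closedBall_zero_iff.2 hy) hmin' (mem_closedBall_zero_iff.2 hz)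
  have h' := mul_le_mul_of_nonneg_left h hΘ.le
  simp only [inner_neg_left, inner_smul_left, conj_trivial] at h'
  have e1 : Θ * (-(Θ⁻¹ * inner ℝ w y) + τ / Θ * breg y p
      + (0 + τ / Θ * 1) / 2 * ‖z - y‖ ^ 2) =
      -inner ℝ w y + τ * breg y p + τ * breg z y := by
    rw [breg_eq z y]
    field_simp
    ring
  have e2 : Θ * (-(Θ⁻¹ * inner ℝ w z) + τ / Θ * breg z p) =
      -inner ℝ w z + τ * breg z p := by
    field_simp
  rw [e1, e2] at h'
  rw [inner_sub_right]
  linarith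

/-- Summation of the dual steps with extrapolated directions `w i`. -/
theorem sum_dual_le {τ : ℝ} (hτ : 0 < τ) {z : H} {w q B y : ℕ → H} (hB : B 0 = 0) (hy : y 0 = 0)
    {n : ℕ} (hq : ∀ i < n, q i = w i + B (i + 1) - B i)
    (hstep : ∀ i < n, inner ℝ (w i) (z - y (i + 1)) + τ * breg (y (i + 1)) (y i)
      + τ * breg z (y (i + 1)) ≤ τ * breg z (y i)) :
    ∑ i ∈ Finset.range n, inner ℝ (q i) (z - y (i + 1)) ≤
      τ / 2 * ‖z‖ ^ 2 + ∑ i ∈ Finset.range n, ‖B (i + 1)‖ ^ 2 / (2 * τ) := by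
  have young : ∀ b x : H, inner ℝ b x ≤ ‖b‖ ^ 2 / (2 * τ) + τ * (1 / 2 * ‖x‖ ^ 2) := by
    intro b x
    refine (real_inner_le_norm b x).trans ?_
    have e : ‖b‖ ^ 2 / (2 * τ) + τ * (1 / 2 * ‖x‖ ^ 2) - ‖b‖ * ‖x‖ =
        (‖b‖ - τ * ‖x‖) ^ 2 / (2 * τ) := by
      field_simp
      ring
    have : 0 ≤ (‖b‖ - τ * ‖x‖) ^ 2 / (2 * τ) := by positivity
    linarith
  have key : ∀ k ≤ n, ∑ i ∈ Finset.range k, inner ℝ (q i) (z - y (i + 1)) + τ * breg z (y k)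
      ≤ τ / 2 * ‖z‖ ^ 2 + inner ℝ (B k) (z - y k)
        + ∑ i ∈ Finset.range k, ‖B i‖ ^ 2 / (2 * τ) := by
    intro k
    induction k with
    | zero =>
      intro _
      simp only [Finset.range_zero, Finset.sum_empty, hB, hy, breg_eq, inner_zero_left, sub_zero]
      linarith
    | succ k ih =>
      intro hk
      have h1 := ih (by omega)
      have h2 := hstep k (by omega)
      rw [Finset.sum_range_succ, Finset.sum_range_succ, hq k (by omega), inner_sub_left,
        inner_add_left]
      have h3 := young (B k) (y (k + 1) - y k)
      rw [← breg_eq] at h3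
      have h4 : inner ℝ (B k) (y (k + 1) - y k) =
          inner ℝ (B k) (z - y k) - inner ℝ (B k) (z - y (k + 1)) := by
        rw [← inner_sub_right]
        congr 1
        abel
      linarith
  have h1 := key n le_rfl
  -- The pairing left at the end is paid for by the unused term τ D(z, y n).
  have h2 := young (B n) (z - y n)
  rw [← breg_eq] at h2
  have h3 : ∑ i ∈ Finset.range n, ‖B i‖ ^ 2 / (2 * τ) + ‖B n‖ ^ 2 / (2 * τ) =
      ∑ i ∈ Finset.range n, ‖B (i + 1)‖ ^ 2 / (2 * τ) := by
    rw [← Finset.sum_range_succ, Finset.sum_range_succ' _ n, hB]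
    simp
  linarith

end DualStep

/-! ### Reindexing by periods and shifting by a delay. -/

section Sums

theorem sum_Ico_int {α : Type*} [AddCommMonoid α] (f : ℤ → α) (a : ℤ) (r : ℕ) :
    ∑ k ∈ Finset.Ico a (a + r), f k = ∑ j ∈ Finset.range r, f (a + j) := by
  refine Finset.sum_nbij' (fun k => (k - a).toNat) (fun j => a + j) ?_ ?_ ?_ ?_ ?_
  · intro k hk
    have := Finset.mem_Ico.1 hk
    simp only [Finset.mem_range]
    omega
  · intro j hj
    have := Finset.mem_range.1 hj
    simp only [Finset.mem_Ico]
    omega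
  · intro k hk
    have := Finset.mem_Ico.1 hk
    omega
  · intro j _
    simp
  · intro k hk
    have := Finset.mem_Ico.1 hk
    congr 1
    omega

theorem sum_range_mul_eq {α : Type*} [AddCommMonoid α] (f : ℕ → α) (r n : ℕ) :
    ∑ k ∈ Finset.range (r * n), f k =
      ∑ i ∈ Finset.range n, ∑ j ∈ Finset.range r, f (r * i + j) := by
  induction n with
  | zero => simp
  | succ n ih => rw [Nat.mul_succ, Finset.sum_range_add, ih, Finset.sum_range_succ]

/-- The first r terms look back to negative times and see only D0; the others are reindexed, and the
missing last r terms are nonnegative. -/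
theorem sum_mul_shift_le {h : ℕ → ℝ} (hh : ∀ k, 0 ≤ h k) {D : ℤ → ℝ} (hD : ∀ k, 0 ≤ D k)
    {D0 : ℝ} (hD0 : ∀ k < 0, D k = D0) {r n : ℕ} (hrn : r ≤ n) :
    ∑ k ∈ Finset.range n, h k * D (k - r) ≤
      D0 * ∑ k ∈ Finset.range r, h k + ∑ j ∈ Finset.range n, h (j + r) * D j := by
  obtain ⟨l, rfl⟩ := Nat.exists_eq_add_of_le hrn
  rw [Finset.sum_range_add, Finset.mul_sum]
  refine add_le_add (Finset.sum_le_sum fun k hk => ?_) ?_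
  · have := Finset.mem_range.1 hk
    rw [hD0 _ (by omega), mul_comm]
  · have e : ∀ j, h (r + j) * D (((r + j : ℕ) : ℤ) - r) = h (j + r) * D j := by
      intro j
      rw [add_comm r j]
      congr 2
      push_cast
      ring
    simp_rw [e]
    refine Finset.sum_le_sum_of_subset_of_nonneg ?_ fun j _ _ => mul_nonneg (hh _) (hD _)
    exact Finset.range_subset_range.2 (by omega)

end Sums

namespace Problem

variable {m d S : ℕ} {n : Fin S → ℕ} {P : Problem m d S n}

/-! ### The lifted problem -/

theorem GrowthCondition.strongConvexOn (hgrowth : P.GrowthCondition) (hX : Convex ℝ P.X)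
    (v : Fin m) : StrongConvexOn P.X P.μ (P.f v) :=
  strongConvexOn_of_subgradient hX fun x hx x' hx' => (hgrowth v x hx x' hx').1

theorem consensus_mem (hm : 0 < m) (hX : Convex ℝ P.X) {Z : Lifted m d} (hZ : Z ∈ P.lifted) :
    (m : ℝ)⁻¹ • ∑ v, Z v ∈ P.X := by
  have h := hX.centerMass_mem (t := Finset.univ) (w := fun _ : Fin m => (1 : ℝ)) (z := fun v => Z v)
    (fun _ _ => zero_le_one) (by simpa using hm) fun v _ => hZ v
  simpa [Finset.centerMass] using h

theorem convex_lifted (hX : Convex ℝ P.X) : Convex ℝ P.lifted :=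
  fun _ hx _ hy _ _ ha hb hab v => hX (hx v) (hy v) ha hb hab

theorem convexOn_F (hX : Convex ℝ P.X) (hf : ∀ v, ConvexOn ℝ P.X (P.f v)) :
    ConvexOn ℝ P.lifted P.F := by
  refine ⟨convex_lifted hX, fun x hx y hy a b ha hb hab => ?_⟩
  simp only [F, smul_eq_mul, Finset.mul_sum]
  rw [← Finset.sum_add_distrib]
  exact Finset.sum_le_sum fun v _ => (hf v).2 (hx v) (hy v) ha hb hab

theorem breg_lifted (Z W : Lifted m d) : breg Z W = ∑ v, breg (Z v) (W v) := by
  simp only [breg_eq, ← Finset.mul_sum]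
  rw [PiLp.norm_sq_eq_of_L2]
  rfl

theorem breg_nonneg {H : Type*} [NormedAddCommGroup H] [InnerProductSpace ℝ H] (x z : H) :
    0 ≤ breg x z := by
  rw [breg_eq]
  positivity

/-- The subgradients G come from similarity and need not be the oracle f'. Strong convexity supplies
the quadratic term for them as well. -/
theorem F_consensus_le (hgrowth : P.GrowthCondition) (hX : Convex ℝ P.X) (hm : 0 < m)
    {G : Lifted m d → Lifted m d} (hG : P.IsSubgradientOracle G) {Z : Lifted m d}
    (hZ : Z ∈ P.lifted) :
    P.F (consensus Z) + inner ℝ (G (consensus Z)) (Z - consensus Z)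
      + P.μ / 2 * ‖Z - consensus Z‖ ^ 2 ≤ P.F Z := by
  have hmem : consensus Z ∈ P.lifted := fun _ => consensus_mem hm hX hZ
  have h := Finset.sum_le_sum fun v (_ : v ∈ Finset.univ) =>
    subgradient_add_sq_le (hgrowth.strongConvexOn hX v) (hmem v) (hG _ hmem v) (hZ v)
  rw [Finset.sum_add_distrib, Finset.sum_add_distrib, ← Finset.mul_sum] at h
  rw [PiLp.inner_apply, PiLp.norm_sq_eq_of_L2]
  exact h

/-- The sum of the f_v has modulus mμ, and the factor m is exactly what turns the distance in ℝ^d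
into the distance between constant families. -/
theorem F_diag_add_le (hgrowth : P.GrowthCondition) (hX : Convex ℝ P.X) (hm : 0 < m)
    {xs : Vec d} (hxs : xs ∈ P.X) (hopt : IsMinOn (fun x => ∑ v, P.f v x) P.X xs)
    {Z : Lifted m d} (hZ : Z ∈ P.lifted) :
    P.F (diag m xs) + P.μ / 2 * ‖consensus Z - diag m xs‖ ^ 2 ≤ P.F (consensus Z) := by
  have h := add_sq_le_of_isMinOn (strongConvexOn_sum hX Finset.univ
    fun v _ => hgrowth.strongConvexOn hX v) hxs hopt (consensus_mem hm hX hZ)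
  have e : ‖consensus Z - diag m xs‖ ^ 2 = m * ‖(m : ℝ)⁻¹ • ∑ v, Z v - xs‖ ^ 2 := by
    rw [PiLp.norm_sq_eq_of_L2]
    change ∑ v : Fin m, ‖(m : ℝ)⁻¹ • ∑ v, Z v - xs‖ ^ 2 = _
    rw [Finset.sum_const, Finset.card_univ, Fintype.card_fin, nsmul_eq_mul]
  rw [Finset.sum_const, Finset.card_univ, Fintype.card_fin, nsmul_eq_mul] at h
  change ∑ v, P.f v xs + _ ≤ ∑ v, P.f v ((m : ℝ)⁻¹ • ∑ v', Z v')
  rw [e]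
  linarith

theorem inner_sub_consensus_ge (hm : 0 < m) (W Z : Lifted m d) :
    -(‖W - consensus W‖ * ‖Z - consensus Z‖) ≤ inner ℝ W (Z - consensus Z) := by
  have h1 : inner ℝ W (Z - consensus Z) = inner ℝ (W - consensus W) (Z - consensus Z) := by
    rw [inner_sub_left, inner_sub_consensus hm (W := consensus W) (fun _ _ => rfl), sub_zero]
  rw [h1]
  exact neg_le_of_abs_le (abs_real_inner_le_norm _ _)

/-- Only the component (I - Π)G pairs with Z - ΠZ, and similarity bounds it at the consensus point
ΠZ. -/
theorem IsSimilar.F_consensus_le {a : ℝ} (ha : P.IsSimilar a) (hgrowth : P.GrowthCondition)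
    (hX : Convex ℝ P.X) (hm : 0 < m) (hkernel : P.KernelCondition) {Z : Lifted m d}
    (hZ : Z ∈ P.lifted) :
    P.F (consensus Z) + P.μ / 2 * ‖Z - consensus Z‖ ^ 2 ≤ P.F Z + a * ‖Z - consensus Z‖ := by
  obtain ⟨G, hG, hGa⟩ := ha
  have h1 := Problem.F_consensus_le hgrowth hX hm hG hZ
  have h2 := inner_sub_consensus_ge hm (G (consensus Z)) Z
  have h3 := mul_le_mul_of_nonneg_right (hGa (consensus Z) (fun _ => consensus_mem hm hX hZ)
    (hkernel.stacked_consensus Z)) (norm_nonneg (Z - consensus Z))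
  linarith

theorem IsBlockSimilar.F_consensus_le {a : Fin S → ℝ} (ha : P.IsBlockSimilar a) (hμ : 0 < P.μ)
    (hgrowth : P.GrowthCondition) (hX : Convex ℝ P.X) (hm : 0 < m) (hkernel : P.KernelCondition)
    {Z : Lifted m d} (hZ : Z ∈ P.lifted) :
    P.F (consensus Z) ≤ P.F Z + ∑ s, a s * ‖rowProj (P.K s) Z‖ := by
  obtain ⟨horth, G, hG, hGa⟩ := ha
  have h1 := Problem.F_consensus_le hgrowth hX hm hG hZ
  have h2 : -∑ s, a s * ‖rowProj (P.K s) Z‖ ≤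
      inner ℝ (G (consensus Z)) (Z - consensus Z) := by
    rw [← hkernel.sum_rowProj hm horth, inner_sum, ← Finset.sum_neg_distrib]
    refine Finset.sum_le_sum fun s _ => ?_
    rw [inner_rowProj_right]
    have h3 := mul_le_mul_of_nonneg_right (hGa s (consensus Z)
      (fun _ => consensus_mem hm hX hZ) (hkernel.stacked_consensus Z))
      (norm_nonneg (rowProj (P.K s) Z))
    have h4 := neg_le_of_abs_le (abs_real_inner_le_norm (rowProj (P.K s) (G (consensus Z)))
      (rowProj (P.K s) Z))
    linarith
  have h5 : 0 ≤ P.μ / 2 * ‖Z - consensus Z‖ ^ 2 := by positivity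
  linarith

/-- Points with a small objective value are close to the optimal consensus point. -/
theorem IsSimilar.breg_diag_le {a : ℝ} (ha : P.IsSimilar a) (ha0 : 0 < a) (hμ : 0 < P.μ)
    (hgrowth : P.GrowthCondition)
    (hX : Convex ℝ P.X) (hm : 0 < m) (hkernel : P.KernelCondition)
    {xs : Vec d} (hxs : xs ∈ P.X) (hopt : IsMinOn (fun x => ∑ v, P.f v x) P.X xs)
    {Z : Lifted m d} (hZ : Z ∈ P.lifted) (hF : P.F Z ≤ P.F (diag m xs) + a ^ 2 / P.μ) :
    breg (diag m xs) Z ≤ 4 * a ^ 2 / P.μ ^ 2 := by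
  have h1 := ha.F_consensus_le hgrowth hX hm hkernel hZ
  have h2 := F_diag_add_le hgrowth hX hm hxs hopt hZ
  have h3 := norm_sub_sq_eq_add_consensus hm (W := diag m xs) (fun _ _ => rfl) Z
  set r := ‖Z - diag m xs‖
  have hr : 0 ≤ r := norm_nonneg _
  have h4 : ‖Z - consensus Z‖ ≤ r := by
    refine le_of_sq_le_sq ?_ hr
    rw [h3]
    exact le_add_of_nonneg_right (sq_nonneg _)
  have h5 : P.μ / 2 * r ^ 2 ≤ a * r + a ^ 2 / P.μ := by
    rw [h3]
    have := mul_le_mul_of_nonneg_left h4 ha0.le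
    linarith
  rw [breg_eq, norm_sub_rev, le_div_iff₀ (by positivity)]
  have h6 : (P.μ * r) ^ 2 ≤ 2 * a * (P.μ * r) + 2 * a ^ 2 := by
    have := mul_le_mul_of_nonneg_left h5 (by positivity : 0 ≤ 2 * P.μ)
    have e : 2 * P.μ * (a * r + a ^ 2 / P.μ) = 2 * a * (P.μ * r) + 2 * a ^ 2 := by
      field_simp
    linarith
  -- The quadratic inequality gives μr ≤ (1 + √3)a. The rational bound 14/5 suffices since (14/5)²/2
  -- < 4.
  have h7 : P.μ * r ≤ 14 / 5 * a := by
    by_contra! hlt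
    nlinarith
  change 1 / 2 * r ^ 2 * P.μ ^ 2 ≤ _
  have h8 : 0 ≤ P.μ * r := by positivity
  nlinarith

theorem IsLocalInit.mem (hX : Convex ℝ P.X) {a Dx : ℝ} {T0 : ℕ} {x0 zinit : Lifted m d}
    (h : P.IsLocalInit a Dx T0 x0 zinit) (hT : 1 ≤ T0) : zinit ∈ P.lifted := by
  intro v
  obtain ⟨u, hu⟩ := h.sliding v
  exact (hu.mem hX hT).2

/-- Of each agent's budget ε₀/m, the prox term at x uses at most one half by the choice of η, and
the sliding error at most one quarter by the choice of the step count. -/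
theorem IsLocalInit.F_le (hX : Convex ℝ P.X) (hμ : 0 < P.μ) (hgrowth : P.GrowthCondition)
    (hm : 0 < m) {a Dx : ℝ} (ha : 0 < a) {T0 : ℕ} {x0 zinit : Lifted m d}
    (h : P.IsLocalInit a Dx T0 x0 zinit) (hT : 1 ≤ T0) {x : Vec d} (hx : x ∈ P.X) :
    P.F zinit ≤ P.F (diag m x) + a ^ 2 / P.μ := by
  have hDx := h.Dx_pos
  have hm' : (0 : ℝ) < m := by exact_mod_cast hm
  have hT' : (0 : ℝ) < T0 := by exact_mod_cast hT
  set e := a ^ 2 / P.μ / 2 / (m * Dx) with he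
  have hepos : 0 < e := by positivity
  have hv : ∀ v, P.f v (zinit v) ≤ P.f v x + a ^ 2 / P.μ / m := by
    intro v
    obtain ⟨u, hu⟩ := h.sliding v
    have hg := hu.gap_le (hgrowth v) hX hμ hT (fun _ => hepos.le) hepos (by simp) (h.start_mem v) hx
    have hD := mul_le_mul_of_nonneg_left (h.start_bound v x hx) hepos.le
    have herr := slidingErr_le (M := P.M) hμ hepos hT
    have hs := h.steps
    have e1 : a ^ 2 / P.μ * P.μ = a ^ 2 := by field_simp
    rw [e1, div_le_iff₀ (by positivity)] at hs
    have e2 : 2 * P.M ^ 2 / (T0 * P.μ) ≤ a ^ 2 / P.μ / m / 4 := by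
      rw [div_div, div_div, div_le_div_iff₀ (by positivity) (by positivity)]
      nlinarith
    have e3 : e * Dx = a ^ 2 / P.μ / m / 2 := by
      rw [he]
      field_simp
    have h0 : 0 ≤ a ^ 2 / P.μ / m := by positivity
    have h1 := mul_nonneg hepos.le (breg_nonneg (zinit v) (x0 v))
    have h2 := mul_nonneg (by positivity : 0 ≤ P.μ + e) (breg_nonneg x u)
    simp only [Finset.univ_unique, Finset.sum_const, Finset.card_singleton, one_smul,
      inner_zero_left] at hg
    linarith
  calc P.F zinit ≤ ∑ v : Fin m, (P.f v x + a ^ 2 / P.μ / m) := Finset.sum_le_sum fun v _ => hv v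
    _ = P.F (diag m x) + a ^ 2 / P.μ := by
      rw [Finset.sum_add_distrib, Finset.sum_const, Finset.card_univ, Fintype.card_fin,
        nsmul_eq_mul, mul_div_cancel₀ _ hm'.ne']
      rfl

/-! ### The parameters -/

section Parameters

variable {ρ : Fin S → ℝ}

theorem moment_pos (hS : 0 < S) (hr : ∀ s, 0 < P.r s) (hρ : ∀ s, 0 < ρ s) (j : ℕ) :
    0 < P.moment ρ j := by
  refine Finset.sum_pos (fun s _ => ?_) ⟨⟨0, hS⟩, Finset.mem_univ _⟩
  have := hr s
  have := hρ s
  positivity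

theorem moment_two_div_le (hS : 0 < S) (hr : ∀ s, 0 < P.r s) (hρ : ∀ s, 0 < ρ s) {N : ℕ}
    (hN : P.Admissible N) : P.moment ρ 2 / P.moment ρ 1 ≤ N + 1 := by
  rw [div_le_iff₀ (moment_pos hS hr hρ 1), moment, moment, Finset.mul_sum]
  refine Finset.sum_le_sum fun s _ => ?_
  have h1 : (P.r s : ℝ) ≤ N + 1 := by exact_mod_cast Nat.le_of_dvd (Nat.succ_pos N) (hN s)
  have h2 : 0 ≤ ρ s * (P.r s : ℝ) := mul_nonneg (hρ s).le (Nat.cast_nonneg _)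
  nlinarith

variable (P ρ) in
/-- The weight `θ_k η_k` of the proximal terms. -/
noncomputable def proxWeight (k : ℕ) : ℝ := P.theta ρ k * P.eta ρ k

theorem theta_pos (hS : 0 < S) (hr : ∀ s, 0 < P.r s) (hρ : ∀ s, 0 < ρ s) (k : ℕ) :
    0 < P.theta ρ k := by
  have := moment_pos hS hr hρ 1
  have := moment_pos hS hr hρ 2
  rw [theta]
  push_cast
  positivity

theorem eta_pos (hS : 0 < S) (hr : ∀ s, 0 < P.r s) (hρ : ∀ s, 0 < ρ s) (hμ : 0 < P.μ) (k : ℕ) :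
    0 < P.eta ρ k := by
  have := moment_pos hS hr hρ 1
  have := moment_pos hS hr hρ 2
  rw [eta]
  positivity

theorem theta_mul_le_eta (hS : 0 < S) (hr : ∀ s, 0 < P.r s) (hρ : ∀ s, 0 < ρ s) (hμ : 0 < P.μ)
    (k : ℕ) : P.theta ρ k * (P.μ / (4 * P.moment ρ 1)) ≤ P.eta ρ k := by
  have h1 := moment_pos hS hr hρ 1
  have h2 := moment_pos hS hr hρ 2
  have e : P.eta ρ k = (2 * k + 2 * (P.moment ρ 2 / P.moment ρ 1)) *
      (P.μ / (4 * P.moment ρ 1)) := by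
    rw [eta]
    field_simp
    ring
  rw [e, theta]
  refine mul_le_mul_of_nonneg_right ?_ (by positivity)
  push_cast
  have : (0 : ℝ) ≤ k := Nat.cast_nonneg k
  linarith

theorem proxWeight_nonneg (hS : 0 < S) (hr : ∀ s, 0 < P.r s) (hρ : ∀ s, 0 < ρ s) (hμ : 0 < P.μ)
    (k : ℕ) : 0 ≤ P.proxWeight ρ k :=
  (mul_pos (theta_pos hS hr hρ k) (eta_pos hS hr hρ hμ k)).le

/-- The parameter identity behind the telescoping of the primal proximal terms. -/
theorem sum_proxWeight_add (hS : 0 < S) (hr : ∀ s, 0 < P.r s) (hρ : ∀ s, 0 < ρ s)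
    (hsum : ∑ s, ρ s = 1) (k : ℕ) :
    ∑ s, ρ s * P.proxWeight ρ (k + P.r s) = P.theta ρ k * (P.μ + P.eta ρ k) := by
  have h1 := moment_pos hS hr hρ 1
  set R1 := P.moment ρ 1 with hR1
  set R2 := P.moment ρ 2 with hR2
  have e : ∀ s, ρ s * P.proxWeight ρ (k + P.r s) =
      P.proxWeight ρ k * ρ s + P.μ / (2 * R1) * (2 * k + 3 * (R2 / R1)) * (ρ s * (P.r s : ℝ) ^ 1)
        + P.μ / (2 * R1) * (ρ s * (P.r s : ℝ) ^ 2) := by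
    intro s
    simp only [proxWeight, theta, eta, ← hR1, ← hR2]
    push_cast
    ring
  simp_rw [e]
  rw [Finset.sum_add_distrib, Finset.sum_add_distrib, ← Finset.mul_sum, ← Finset.mul_sum,
    ← Finset.mul_sum, hsum]
  change _ + _ * R1 + _ * R2 = _
  simp only [proxWeight, theta, eta, ← hR1, ← hR2]
  push_cast
  field_simp
  ring

/-- With c = r²/r̄ in terms of the moments, the sum of (k + 2c)(k + c) over k < r is at most its
integral r³/3 + (3/2)c r² + 2c² r. Averaging over ρ merges the last two terms, whence 7/2 = 3/2 + 2.
-/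
theorem sum_range_proxWeight_le (hS : 0 < S) (hr : ∀ s, 0 < P.r s) (hρ : ∀ s, 0 < ρ s)
    (hμ : 0 < P.μ) :
    ∑ s, ρ s * ∑ k ∈ Finset.range (P.r s), P.proxWeight ρ k ≤
      P.μ / (2 * P.moment ρ 1) *
        (P.moment ρ 3 / 3 + 7 / 2 * (P.moment ρ 2 ^ 2 / P.moment ρ 1)) := by
  have h1 := moment_pos hS hr hρ 1
  have h2 := moment_pos hS hr hρ 2
  set R1 := P.moment ρ 1 with hR1
  set R2 := P.moment ρ 2 with hR2
  have hle : ∀ r : ℕ, ∑ k ∈ Finset.range r, P.proxWeight ρ k ≤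
      P.μ / (2 * R1) * ((r : ℝ) ^ 3 / 3 + 3 / 2 * (R2 / R1) * (r : ℝ) ^ 2
        + 2 * (R2 / R1) ^ 2 * (r : ℝ) ^ 1) := by
    intro r
    induction r with
    | zero => simp
    | succ r ih =>
      rw [Finset.sum_range_succ]
      have e : P.proxWeight ρ r = P.μ / (2 * R1) * ((r + 2 * (R2 / R1)) * (r + R2 / R1)) := by
        simp only [proxWeight, theta, eta, ← hR1, ← hR2]
        push_cast
        ring
      rw [e]
      refine (add_le_add_left ih _).trans ?_
      rw [← mul_add]
      refine mul_le_mul_of_nonneg_left ?_ (by positivity)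
      have hc : 0 ≤ R2 / R1 := by positivity
      have hr0 : (0 : ℝ) ≤ r := Nat.cast_nonneg r
      push_cast
      nlinarith
  refine (Finset.sum_le_sum fun s _ => mul_le_mul_of_nonneg_left (hle (P.r s)) (hρ s).le).trans ?_
  have e : ∀ s, ρ s * (P.μ / (2 * R1) * ((P.r s : ℝ) ^ 3 / 3 + 3 / 2 * (R2 / R1) * (P.r s : ℝ) ^ 2
      + 2 * (R2 / R1) ^ 2 * (P.r s : ℝ) ^ 1)) =
      P.μ / (2 * R1) / 3 * (ρ s * (P.r s : ℝ) ^ 3)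
      + P.μ / (2 * R1) * (3 / 2 * (R2 / R1)) * (ρ s * (P.r s : ℝ) ^ 2)
      + P.μ / (2 * R1) * (2 * (R2 / R1) ^ 2) * (ρ s * (P.r s : ℝ) ^ 1) := by
    intro s
    ring
  simp_rw [e]
  rw [Finset.sum_add_distrib, Finset.sum_add_distrib, ← Finset.mul_sum, ← Finset.mul_sum,
    ← Finset.mul_sum]
  change _ * P.moment ρ 3 + _ * R2 + _ * R1 ≤ _
  refine le_of_eq ?_
  field_simp
  ring

theorem sum_theta (N : ℕ) : ∑ k ∈ Finset.range (N + 1), P.theta ρ k =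
    N * (N + 1) / 2 + 2 * (N + 1) * (P.moment ρ 2 / P.moment ρ 1) := by
  induction N with
  | zero => simp [theta]
  | succ N ih =>
    rw [Finset.sum_range_succ, ih, theta]
    push_cast
    ring

end Parameters

end Problem

namespace Problem

variable {m d S : ℕ} {n : Fin S → ℕ} {P : Problem m d S n} {ρ : Fin S → ℝ}

/-! ### The dual updates -/

variable (P ρ) in
/-- The weighted sum of `X̂^k - X^{k - r_s}` over the `i`-th period of block `s`. -/
noncomputable def periodDiff (Z Zhat : ℤ → Lifted m d) (s : Fin S) (i : ℤ) : Lifted m d :=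
  ∑ j ∈ Finset.range (P.r s), P.theta ρ (P.r s * i + j) •
    (Zhat (P.r s * i + j) - Z (P.r s * i + j - P.r s))

/-- In this form, adding the correction of the current period and removing that of the previous one
yields the true weighted sum of X̂^k. -/
theorem extrapolation_eq (Z Zhat : ℤ → Lifted m d) (s : Fin S) (i : ℕ) :
    P.extrapolation ρ Z Zhat s i = P.periodDiff ρ Z Zhat s ((i : ℤ) - 1) +
      ∑ j ∈ Finset.range (P.r s), P.theta ρ (P.r s * i + j) • Z (P.r s * i + j - P.r s) := by
  have e : Finset.Ico ((P.r s : ℤ) * i - P.r s) ((P.r s : ℤ) * i) =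
      Finset.Ico ((P.r s : ℤ) * i - P.r s) ((P.r s : ℤ) * i - P.r s + P.r s) := by
    rw [sub_add_cancel]
  rw [extrapolation, periodDiff, e, sum_Ico_int, sum_Ico_int]
  congr 1
  · refine Finset.sum_congr rfl fun j _ => ?_
    rw [show (P.r s : ℤ) * ((i : ℤ) - 1) + j = (P.r s : ℤ) * i - P.r s + j by ring]
  · refine Finset.sum_congr rfl fun j _ => ?_
    rw [show (P.r s : ℤ) * i - P.r s + j + P.r s = (P.r s : ℤ) * i + j by ring,
      show (P.r s : ℤ) * i - P.r s + j = (P.r s : ℤ) * i + j - P.r s by ring]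

theorem thetaSum_pos (hS : 0 < S) (hr : ∀ s, 0 < P.r s) (hρ : ∀ s, 0 < ρ s) (s : Fin S) (i : ℕ) :
    0 < P.thetaSum ρ s i := by
  rw [thetaSum, sum_Ico_int]
  refine Finset.sum_pos (fun j _ => ?_) ⟨0, Finset.mem_range.2 (hr s)⟩
  exact_mod_cast theta_pos hS hr hρ (P.r s * i + j)

theorem tau_pos (hS : 0 < S) (hK : ∀ s, P.K s ≠ 0) (hr : ∀ s, 0 < P.r s) (hρ : ∀ s, 0 < ρ s)
    (hμ : 0 < P.μ) (s : Fin S) : 0 < P.tau ρ s := by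
  have h1 := norm_pos_iff.2 (hK s)
  have h2 := hρ s
  have h3 := moment_pos hS hr hρ 1
  have h4 := hr s
  rw [tau]
  positivity

/-- This is where τ_s is fixed: ρ_s τ_s μ/(4r̄) = r_s‖K_s‖². Cauchy-Schwarz over a period costs the
factor r_s, and one factor θ_k is traded for η_k by `theta_mul_le_eta`. -/
theorem norm_map_periodDiff_le (hS : 0 < S) (hK : ∀ s, P.K s ≠ 0) (hr : ∀ s, 0 < P.r s)
    (hρ : ∀ s, 0 < ρ s) (hμ : 0 < P.μ) (Z Zhat : ℤ → Lifted m d) (s : Fin S) (i : ℕ) :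
    ‖P.K s (P.periodDiff ρ Z Zhat s i)‖ ^ 2 / (2 * P.tau ρ s) ≤
      ∑ j ∈ Finset.range (P.r s), P.proxWeight ρ (P.r s * i + j) *
        (ρ s * breg (Zhat (P.r s * i + j)) (Z (P.r s * i + j - P.r s))) := by
  have hτ := tau_pos hS hK hr hρ hμ s
  have hR1 := moment_pos hS hr hρ 1
  have hKs := norm_pos_iff.2 (hK s)
  have hρs := hρ s
  have hrs : (0 : ℝ) < P.r s := by exact_mod_cast hr s
  set Δ : ℕ → Lifted m d := fun j => Zhat (P.r s * i + j) - Z (P.r s * i + j - P.r s) with hΔ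
  set θ : ℕ → ℝ := fun j => P.theta ρ (P.r s * i + j) with hθ
  have hcast : ∀ j : ℕ, ((P.r s : ℤ) * i + j) = ((P.r s * i + j : ℕ) : ℤ) := by
    intro j
    push_cast
    ring
  have hθpos : ∀ j, 0 < θ j := by
    intro j
    simp only [hθ, hcast]
    exact theta_pos hS hr hρ _
  have h1 : ‖P.periodDiff ρ Z Zhat s i‖ ^ 2 ≤
      P.r s * ∑ j ∈ Finset.range (P.r s), (θ j * ‖Δ j‖) ^ 2 := by
    have h2 : ‖P.periodDiff ρ Z Zhat s i‖ ≤ ∑ j ∈ Finset.range (P.r s), θ j * ‖Δ j‖ := by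
      refine (norm_sum_le _ _).trans (le_of_eq (Finset.sum_congr rfl fun j _ => ?_))
      rw [norm_smul, Real.norm_of_nonneg (hθpos j).le]
    refine (pow_le_pow_left₀ (norm_nonneg _) h2 2).trans ?_
    have := sq_sum_le_card_mul_sum_sq (s := Finset.range (P.r s)) (f := fun j => θ j * ‖Δ j‖)
    rwa [Finset.card_range] at this
  have h2 : ‖P.K s (P.periodDiff ρ Z Zhat s i)‖ ^ 2 ≤
      ‖P.K s‖ ^ 2 * (P.r s * ∑ j ∈ Finset.range (P.r s), (θ j * ‖Δ j‖) ^ 2) := by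
    refine (pow_le_pow_left₀ (norm_nonneg _) ((P.K s).le_opNorm _) 2).trans ?_
    rw [mul_pow]
    exact mul_le_mul_of_nonneg_left h1 (sq_nonneg _)
  rw [div_le_iff₀ (by positivity)]
  refine h2.trans ?_
  rw [Finset.sum_mul, Finset.mul_sum, Finset.mul_sum]
  refine Finset.sum_le_sum fun j _ => ?_
  have h3 := theta_mul_le_eta hS hr hρ hμ (P.r s * i + j)
  have e : P.proxWeight ρ (P.r s * i + j) = θ j * P.eta ρ (P.r s * i + j) := by
    simp only [hθ, hcast, proxWeight]
  rw [e, breg_eq]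
  rw [← hcast] at h3
  change θ j * _ ≤ _ at h3
  have h4 : 0 ≤ θ j * ρ s * P.tau ρ s * ‖Δ j‖ ^ 2 := by
    have := hθpos j
    positivity
  have h5 := mul_le_mul_of_nonneg_left h3 h4
  have e2 : θ j * ρ s * P.tau ρ s * ‖Δ j‖ ^ 2 * (θ j * (P.μ / (4 * P.moment ρ 1))) =
      ‖P.K s‖ ^ 2 * (P.r s * (θ j * ‖Δ j‖) ^ 2) := by
    rw [tau]
    field_simp
  rw [e2] at h5
  refine h5.trans (le_of_eq ?_)
  simp only [hΔ]
  ring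

theorem IsRun.sum_dual_le {c : Fin S → ℝ} {N T : ℕ} {zinit : Lifted m d}
    {Z Zhat : ℤ → Lifted m d} {y : ∀ s, ℤ → Vec (n s)}
    (hrun : P.IsRun ρ (fun s y => c s * ‖y‖) N T zinit Z Zhat y)
    (hS : 0 < S) (hK : ∀ s, P.K s ≠ 0) (hr : ∀ s, 0 < P.r s)
    (hρ : ∀ s, 0 < ρ s) (hμ : 0 < P.μ) (hN : P.Admissible N) (s : Fin S) (hc : 0 ≤ c s)
    {z : Vec (n s)} (hz : ‖z‖ ≤ c s) :
    ∑ k ∈ Finset.range (N + 1), P.theta ρ k *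
        inner ℝ (P.K s (Zhat k)) (z - y s ((k / P.r s : ℕ) : ℤ)) ≤
      P.tau ρ s / 2 * ‖z‖ ^ 2 + ∑ k ∈ Finset.range (N + 1), P.proxWeight ρ k *
        (ρ s * breg (Zhat k) (Z ((k : ℤ) - P.r s))) := by
  obtain ⟨l, hl⟩ := hN s
  have hτ := tau_pos hS hK hr hρ hμ s
  have hcast : ∀ i j : ℕ, ((P.r s * i + j : ℕ) : ℤ) = (P.r s : ℤ) * i + j := by
    intro i j
    push_cast
    ring
  have hle : ∀ i < l, P.r s * i ≤ N := by
    intro i hi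
    have : P.r s * (i + 1) ≤ P.r s * l := Nat.mul_le_mul_left _ hi
    have := hr s
    rw [mul_add, mul_one] at *
    omega
  -- Local times are shifted by one: index 0 stands for local time -1, where the dual variable is 0.
  have hdual := AMT.sum_dual_le hτ (z := z) (n := l)
    (w := fun i => P.K s (P.extrapolation ρ Z Zhat s i))
    (q := fun i => P.K s (∑ j ∈ Finset.range (P.r s),
      P.theta ρ (P.r s * i + j) • Zhat (P.r s * i + j)))
    (B := fun i => P.K s (P.periodDiff ρ Z Zhat s ((i : ℤ) - 1)))
    (y := fun i => y s ((i : ℤ) - 1)) ?_ (hrun.init_y s _ (by norm_num)) ?_ ?_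
  · rw [hl, sum_range_mul_eq, sum_range_mul_eq]
    have e1 : ∀ i, ∑ j ∈ Finset.range (P.r s), P.theta ρ ((P.r s * i + j : ℕ) : ℤ) *
        inner ℝ (P.K s (Zhat ((P.r s * i + j : ℕ) : ℤ)))
          (z - y s (((P.r s * i + j) / P.r s : ℕ) : ℤ)) =
        inner ℝ (P.K s (∑ j ∈ Finset.range (P.r s),
          P.theta ρ (P.r s * i + j) • Zhat (P.r s * i + j))) (z - y s (((i + 1 : ℕ) : ℤ) - 1)) := by
      intro i
      rw [map_sum, sum_inner]
      refine Finset.sum_congr rfl fun j hj => ?_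
      rw [Nat.mul_add_div (hr s), Nat.div_eq_of_lt (Finset.mem_range.1 hj), map_smul,
        real_inner_smul_left, hcast, add_zero]
      push_cast
      rw [add_sub_cancel_right]
    simp_rw [e1]
    refine hdual.trans (add_le_add_right (Finset.sum_le_sum fun i _ => ?_) _)
    have := norm_map_periodDiff_le hS hK hr hρ hμ Z Zhat s i
    push_cast
    rw [add_sub_cancel_right]
    exact this
  -- Period -1 lies in negative times, where both primal sequences equal the initial point.
  · have h0 : P.periodDiff ρ Z Zhat s (((0 : ℕ) : ℤ) - 1) = 0 := by
      refine Finset.sum_eq_zero fun j hj => ?_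
      have := Finset.mem_range.1 hj
      have h1 : (P.r s : ℤ) * (((0 : ℕ) : ℤ) - 1) + j < 0 := by
        push_cast
        omega
      rw [hrun.init_Zhat _ h1, hrun.init_Z _ (by omega), sub_self, smul_zero]
    simp only [h0, map_zero]
  · intro i _
    rw [← map_add, ← map_sub, extrapolation_eq, Nat.cast_succ, add_sub_cancel_right,
      add_sub_right_comm, add_sub_cancel_left, periodDiff, ← Finset.sum_add_distrib]
    refine congrArg _ (Finset.sum_congr rfl fun j _ => ?_)
    rw [← smul_add, add_sub_cancel]
  · intro i hi
    have h := dual_step hc hτ.le (thetaSum_pos hS hr hρ s i) (hrun.dual s i (hle i hi)) hz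
    push_cast
    rw [add_sub_cancel_right]
    exact h

/-! ### The primal updates -/

theorem IsRun.mem_lifted {R : ∀ s, Vec (n s) → ℝ} {N T : ℕ} {zinit : Lifted m d}
    {Z Zhat : ℤ → Lifted m d} {y : ∀ s, ℤ → Vec (n s)}
    (hrun : P.IsRun ρ R N T zinit Z Zhat y) (hX : Convex ℝ P.X) (hT : 1 ≤ T)
    (hz : zinit ∈ P.lifted) {k : ℤ} (hk : k ≤ N) : Z k ∈ P.lifted ∧ Zhat k ∈ P.lifted := by
  rcases lt_or_ge k 0 with hk0 | hk0
  · rw [hrun.init_Z k hk0, hrun.init_Zhat k hk0]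
    exact ⟨hz, hz⟩
  · lift k to ℕ using hk0
    have h := fun v => (hrun.primal k (by exact_mod_cast hk) v).mem hX hT
    exact ⟨fun v => (h v).1, fun v => (h v).2⟩

/-- The sliding bounds of the agents are added at a common comparison point x. As K_s annihilates
the constant family, the dual force acts on X̂^k alone. -/
theorem IsRun.primal_le {R : ∀ s, Vec (n s) → ℝ} {N T : ℕ} {zinit : Lifted m d}
    {Z Zhat : ℤ → Lifted m d} {y : ∀ s, ℤ → Vec (n s)}
    (hrun : P.IsRun ρ R N T zinit Z Zhat y) (hS : 0 < S) (hr : ∀ s, 0 < P.r s)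
    (hρ : ∀ s, 0 < ρ s) (hsum : ∑ s, ρ s = 1) (hμ : 0 < P.μ) (hgrowth : P.GrowthCondition)
    (hkernel : P.KernelCondition)
    (hX : Convex ℝ P.X) (hT : 1 ≤ T) (hz : zinit ∈ P.lifted) {x : Vec d} (hx : x ∈ P.X) {k : ℕ}
    (hk : k ≤ N) :
    ∑ s, inner ℝ (P.K s (Zhat k)) (y s ((k / P.r s : ℕ) : ℤ)) + P.F (Zhat k) - P.F (diag m x)
        + P.eta ρ k * ∑ s, ρ s * breg (Zhat k) (Z ((k : ℤ) - P.r s))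
        + (P.μ + P.eta ρ k) * breg (diag m x) (Z k) ≤
      P.eta ρ k * ∑ s, ρ s * breg (diag m x) (Z ((k : ℤ) - P.r s))
        + m * slidingErr P.μ P.M (P.eta ρ k) T := by
  have hη := eta_pos hS hr hρ hμ k
  have hZ := (hrun.mem_lifted hX hT hz (k := (k : ℤ) - 1) (by omega)).1
  have hv := fun v => (hrun.primal k hk v).gap_le (hgrowth v) hX hμ hT
    (fun s => (mul_pos hη (hρ s)).le) hη (by rw [← Finset.mul_sum, hsum, mul_one]) (hZ v) hx
  have h := Finset.sum_le_sum fun v (_ : v ∈ Finset.univ) => hv v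
  have e1 : ∀ W : Lifted m d, ∑ v, ∑ s, P.eta ρ k * ρ s * breg (W v) (Z ((k : ℤ) - P.r s) v) =
      P.eta ρ k * ∑ s, ρ s * breg W (Z ((k : ℤ) - P.r s)) := by
    intro W
    rw [Finset.sum_comm, Finset.mul_sum]
    refine Finset.sum_congr rfl fun s _ => ?_
    rw [breg_lifted, ← Finset.mul_sum, mul_assoc]
  have hdiag : ∀ s, P.K s (diag m x) = 0 :=
    (stacked_eq_zero_iff P _).1 ((hkernel (diag m x)).2 fun _ _ => rfl)
  have e2 : ∑ v, inner ℝ (P.dualForce y k v) (Zhat k v - x) =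
      ∑ s, inner ℝ (P.K s (Zhat k)) (y s ((k / P.r s : ℕ) : ℤ)) := by
    change ∑ v, inner ℝ ((∑ s, ContinuousLinearMap.adjoint (P.K s)
      (y s ((k / P.r s : ℕ) : ℤ))) v) ((Zhat k - diag m x) v) = _
    rw [← PiLp.inner_apply, sum_inner]
    refine Finset.sum_congr rfl fun s _ => ?_
    rw [ContinuousLinearMap.adjoint_inner_left, map_sub, hdiag, sub_zero, real_inner_comm]
  have e3 := e1 (diag m x)
  change ∑ v, ∑ s, P.eta ρ k * ρ s * breg x (Z ((k : ℤ) - P.r s) v) = _ at e3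
  have e4 : breg (diag m x) (Z k) = ∑ v, breg x (Z k v) := breg_lifted _ _
  simp only [Finset.sum_add_distrib, Finset.sum_sub_distrib] at h
  rw [e1, e2, e3, ← Finset.mul_sum, ← e4, Finset.sum_const, Finset.card_univ, Fintype.card_fin,
    nsmul_eq_mul] at h
  exact h

end Problem

theorem consensus_consensus {m d : ℕ} (hm : 0 < m) (Z : Lifted m d) :
    consensus (consensus Z) = consensus Z := by
  have hm' : (m : ℝ) ≠ 0 := by positivity
  have h : (m : ℝ)⁻¹ • ∑ v, consensus Z v = (m : ℝ)⁻¹ • ∑ v, Z v := by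
    simp_rw [consensus_apply]
    rw [Finset.sum_const, Finset.card_univ, Fintype.card_fin, ← Nat.cast_smul_eq_nsmul ℝ,
      smul_inv_smul₀ hm']
  rw [consensus, h]
  rfl

/-! ### Assembling the primal and dual estimates. -/

namespace Problem

variable {m d S : ℕ} {n : Fin S → ℕ} {P : Problem m d S n} {ρ : Fin S → ℝ}

variable (P) in
/-- The standing assumptions on a distributed problem with minimizer `xs`. -/
structure IsRegular (xs : Vec d) : Prop where
  convex_X : Convex ℝ P.X
  convexOn_f : ∀ v, ConvexOn ℝ P.X (P.f v)
  μ_pos : 0 < P.μ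
  M_pos : 0 < P.M
  growth : P.GrowthCondition
  S_pos : 0 < S
  K_ne : ∀ s, P.K s ≠ 0
  kernel : P.KernelCondition
  r_pos : ∀ s, 0 < P.r s
  xs_mem : xs ∈ P.X
  opt : IsMinOn (fun x => ∑ v, P.f v x) P.X xs

variable (ρ) in
/-- `ρ` is a probability vector with positive entries. -/
structure IsWeight : Prop where
  pos : ∀ s, 0 < ρ s
  sum_eq_one : ∑ s, ρ s = 1

variable {xs : Vec d}

theorem IsRegular.m_pos (hP : P.IsRegular xs) : 0 < m := pos_of_block_ne_zero hP.S_pos hP.K_ne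

/-- The accumulated errors of the inexact primal updates. -/
theorem IsRegular.sum_slidingErr_le (hP : P.IsRegular xs) (hρ : IsWeight ρ) {a : ℝ} (ha : 0 < a)
    {N T : ℕ} (hN : P.Admissible N) (hN1 : 1 ≤ N) (hT1 : 1 ≤ T) (hT : P.EnoughSteps ρ a N T) :
    ∑ k ∈ Finset.range (N + 1), P.theta ρ k * (m * slidingErr P.μ P.M (P.eta ρ k) T) ≤
      2 * (P.moment ρ 2 / P.moment ρ 1) ^ 2 * a ^ 2 / P.μ := by
  have hμ := hP.μ_pos
  have hM := hP.M_pos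
  have hm : (0 : ℝ) < m := by exact_mod_cast hP.m_pos
  have hR1 := moment_pos hP.S_pos hP.r_pos hρ.pos 1
  have hR2 := moment_pos hP.S_pos hP.r_pos hρ.pos 2
  have hcN := moment_two_div_le hP.S_pos hP.r_pos hρ.pos hN
  have hN' : (1 : ℝ) ≤ N := by exact_mod_cast hN1
  have hT' : (0 : ℝ) < T := by exact_mod_cast hT1
  have hc : 0 < P.moment ρ 2 / P.moment ρ 1 := by positivity
  have hsumθ := sum_theta (P := P) (ρ := ρ) N
  -- Both parts of the step requirement are converted into a bound in a²c²/μ through this identity,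
  -- with c = r²/r̄.
  have hD1 : P.stepConst ρ a * (m * P.M ^ 2) =
      2 * a ^ 2 * (P.moment ρ 2 / P.moment ρ 1) ^ 2 := by
    rw [stepConst, mul_pow, Real.sq_sqrt hm.le]
    field_simp
    ring
  have hD1pos : 0 < P.stepConst ρ a := by
    rw [stepConst]
    have := Real.sqrt_pos.2 hm
    positivity
  rw [EnoughSteps] at hT
  set c := P.moment ρ 2 / P.moment ρ 1 with hcdef
  set R1 := P.moment ρ 1 with hR1def
  set D1 := P.stepConst ρ a with hD1def
  have hT2 : 25 * (N : ℝ) ^ 2 ≤ T ^ 2 * D1 := by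
    have h := (mul_le_mul_of_nonneg_left (le_max_left _ _) (by positivity)).trans hT
    have hs := Real.sqrt_pos.2 hD1pos
    rw [← mul_div_assoc, div_le_iff₀ hs] at h
    have h2 := pow_le_pow_left₀ (by positivity) h 2
    rw [mul_pow, mul_pow, Real.sq_sqrt hD1pos.le] at h2
    linarith
  have hT3 : 64 * R1 * N ≤ T * D1 := by
    have h := (mul_le_mul_of_nonneg_left (le_max_right _ _) (by positivity)).trans hT
    rw [← mul_div_assoc, div_le_iff₀ hD1pos] at h
    linarith
  have hterm : ∀ k ∈ Finset.range (N + 1),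
      P.theta ρ k * (m * slidingErr P.μ P.M (P.eta ρ k) T) ≤
        P.theta ρ k * (m * (P.M ^ 2 / P.μ / T ^ 2)) + 16 * m * P.M ^ 2 * R1 / (P.μ * T) := by
    intro k _
    have hη := eta_pos hP.S_pos hP.r_pos hρ.pos hμ k
    have hθ := theta_pos hP.S_pos hP.r_pos hρ.pos k
    have h1 := slidingErr_le' (M := P.M) hμ hη hT1
    have h2 : P.theta ρ k * (m * (4 * P.M ^ 2 / (T * P.eta ρ k))) ≤
        16 * m * P.M ^ 2 * R1 / (P.μ * T) := by
      have h3 := theta_mul_le_eta hP.S_pos hP.r_pos hρ.pos hμ k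
      rw [← hR1def] at h3
      have e : P.theta ρ k * (m * (4 * P.M ^ 2 / (T * P.eta ρ k))) =
          P.theta ρ k * (P.μ / (4 * R1)) * (16 * m * P.M ^ 2 * R1 / (P.μ * T) / P.eta ρ k) := by
        field_simp
        ring
      rw [e]
      refine (mul_le_mul_of_nonneg_right h3 (by positivity)).trans (le_of_eq ?_)
      field_simp
    have h4 := mul_le_mul_of_nonneg_left (mul_le_mul_of_nonneg_left h1 hm.le) hθ.le
    linarith
  refine (Finset.sum_le_sum hterm).trans ?_
  rw [Finset.sum_add_distrib, ← Finset.sum_mul, hsumθ, Finset.sum_const, Finset.card_range,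
    nsmul_eq_mul]
  -- Uses c ≤ N + 1, which holds because every r_s divides N + 1, together with N ≥ 1.
  have h1 : (N : ℝ) * (N + 1) / 2 + 2 * (N + 1) * c ≤ 9 * N ^ 2 := by nlinarith
  have h2 : ((N : ℝ) * (N + 1) / 2 + 2 * (N + 1) * c) * (m * (P.M ^ 2 / P.μ / T ^ 2)) ≤
      18 / 25 * (a ^ 2 * c ^ 2 / P.μ) := by
    refine (mul_le_mul_of_nonneg_right h1 (by positivity)).trans ?_
    have e1 : 9 * (N : ℝ) ^ 2 * (m * (P.M ^ 2 / P.μ / T ^ 2)) =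
        9 / 25 * (25 * N ^ 2) * (m * P.M ^ 2 / (P.μ * T ^ 2)) := by
      field_simp
    have e2 : 18 / 25 * (a ^ 2 * c ^ 2 / P.μ) =
        9 / 25 * (T ^ 2 * D1) * (m * P.M ^ 2 / (P.μ * T ^ 2)) := by
      have : a ^ 2 * c ^ 2 = D1 * (m * P.M ^ 2) / 2 := by rw [hD1]; ring
      rw [this]
      field_simp
      ring
    rw [e1, e2]
    exact mul_le_mul_of_nonneg_right (mul_le_mul_of_nonneg_left hT2 (by norm_num)) (by positivity)
  have h3 : ((N + 1 : ℕ) : ℝ) * (16 * m * P.M ^ 2 * R1 / (P.μ * T)) ≤ a ^ 2 * c ^ 2 / P.μ := by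
    have e1 : a ^ 2 * c ^ 2 / P.μ = 1 / 2 * (T * D1) * (m * P.M ^ 2 / (P.μ * T)) := by
      have : a ^ 2 * c ^ 2 = D1 * (m * P.M ^ 2) / 2 := by rw [hD1]; ring
      rw [this]
      field_simp
    have e2 : ((N + 1 : ℕ) : ℝ) * (16 * m * P.M ^ 2 * R1 / (P.μ * T)) =
        16 * R1 * (N + 1) * (m * P.M ^ 2 / (P.μ * T)) := by
      push_cast
      field_simp
    rw [e1, e2]
    refine mul_le_mul_of_nonneg_right ?_ (by positivity)
    nlinarith
  have h4 : 0 ≤ a ^ 2 * c ^ 2 / P.μ := by positivity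
  have e : 2 * c ^ 2 * a ^ 2 / P.μ = 2 * (a ^ 2 * c ^ 2 / P.μ) := by ring
  rw [e]
  linarith

/-- The weighted gap of the iterates at the optimal consensus point and fixed dual points. -/
theorem IsRun.sum_gap_le (hP : P.IsRegular xs) (hρ : IsWeight ρ) {c : Fin S → ℝ}
    (hc : ∀ s, 0 ≤ c s) {N T : ℕ} {zinit : Lifted m d}
    {Z Zhat : ℤ → Lifted m d} {y : ∀ s, ℤ → Vec (n s)}
    (hrun : P.IsRun ρ (fun s y => c s * ‖y‖) N T zinit Z Zhat y) (hN : P.Admissible N)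
    (hT : 1 ≤ T) (hz : zinit ∈ P.lifted) {w : ∀ s, Vec (n s)} (hw : ∀ s, ‖w s‖ ≤ c s) :
    ∑ k ∈ Finset.range (N + 1), P.theta ρ k *
        (P.F (Zhat k) - P.F (diag m xs) + ∑ s, inner ℝ (P.K s (Zhat k)) (w s)) ≤
      ∑ s, P.tau ρ s / 2 * c s ^ 2
        + breg (diag m xs) zinit * ∑ s, ρ s * ∑ k ∈ Finset.range (P.r s), P.proxWeight ρ k
        + ∑ k ∈ Finset.range (N + 1),
          P.theta ρ k * (m * slidingErr P.μ P.M (P.eta ρ k) T) := by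
  have hμ := hP.μ_pos
  have hS := hP.S_pos
  set D : ℤ → ℝ := fun k => breg (diag m xs) (Z k) with hD
  have hprimal : ∀ k ∈ Finset.range (N + 1), P.theta ρ k *
      (∑ s, inner ℝ (P.K s (Zhat k)) (y s ((k / P.r s : ℕ) : ℤ)) + P.F (Zhat k)
        - P.F (diag m xs)) + P.proxWeight ρ k * ∑ s, ρ s * breg (Zhat k) (Z ((k : ℤ) - P.r s))
        + P.theta ρ k * (P.μ + P.eta ρ k) * D k ≤
      P.proxWeight ρ k * ∑ s, ρ s * D ((k : ℤ) - P.r s)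
        + P.theta ρ k * (m * slidingErr P.μ P.M (P.eta ρ k) T) := by
    intro k hk
    have h := hrun.primal_le hS hP.r_pos hρ.pos hρ.sum_eq_one hμ hP.growth hP.kernel hP.convex_X
      hT hz hP.xs_mem (Nat.lt_succ_iff.1 (Finset.mem_range.1 hk))
    have h' := mul_le_mul_of_nonneg_left h (theta_pos hS hP.r_pos hρ.pos k).le
    simp only [proxWeight, hD]
    linarith
  have hdual := Finset.sum_le_sum fun s (_ : s ∈ Finset.univ) =>
    hrun.sum_dual_le hS hP.K_ne hP.r_pos hρ.pos hμ hN s (hc s) (hw s)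
  -- Each delay r_s is shifted separately. The ρ-average of the shifted weights is exactly the
  -- coefficient of D k on the primal left side, so only the initial distance survives.
  have htel : ∑ k ∈ Finset.range (N + 1), P.proxWeight ρ k * ∑ s, ρ s * D ((k : ℤ) - P.r s) ≤
      breg (diag m xs) zinit * ∑ s, ρ s * ∑ k ∈ Finset.range (P.r s), P.proxWeight ρ k
        + ∑ k ∈ Finset.range (N + 1), P.theta ρ k * (P.μ + P.eta ρ k) * D k := by
    have h1 : ∀ s, ∑ k ∈ Finset.range (N + 1), P.proxWeight ρ k * D ((k : ℤ) - P.r s) ≤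
        breg (diag m xs) zinit * ∑ k ∈ Finset.range (P.r s), P.proxWeight ρ k
          + ∑ k ∈ Finset.range (N + 1), P.proxWeight ρ (k + P.r s) * D k := fun s =>
      sum_mul_shift_le (proxWeight_nonneg hS hP.r_pos hρ.pos hμ) (fun _ => breg_nonneg _ _)
        (fun k hk => by simp only [hrun.init_Z k hk])
        (Nat.le_of_dvd (Nat.succ_pos N) (hN s))
    have h2 := Finset.sum_le_sum fun s (_ : s ∈ Finset.univ) =>
      mul_le_mul_of_nonneg_left (h1 s) (hρ.pos s).le
    simp only [mul_add, Finset.sum_add_distrib] at h2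
    have e1 : ∑ k ∈ Finset.range (N + 1), P.proxWeight ρ k * ∑ s, ρ s * D ((k : ℤ) - P.r s) =
        ∑ s, ρ s * ∑ k ∈ Finset.range (N + 1), P.proxWeight ρ k * D ((k : ℤ) - P.r s) := by
      simp_rw [Finset.mul_sum]
      rw [Finset.sum_comm]
      exact Finset.sum_congr rfl fun s _ => Finset.sum_congr rfl fun k _ => by ring
    have e2 : ∑ k ∈ Finset.range (N + 1), P.theta ρ k * (P.μ + P.eta ρ k) * D k =
        ∑ s, ρ s * ∑ k ∈ Finset.range (N + 1), P.proxWeight ρ (k + P.r s) * D k := by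
      simp_rw [← sum_proxWeight_add hS hP.r_pos hρ.pos hρ.sum_eq_one, Finset.mul_sum,
        Finset.sum_mul]
      rw [Finset.sum_comm]
      exact Finset.sum_congr rfl fun s _ => Finset.sum_congr rfl fun k _ => by ring
    have e3 : breg (diag m xs) zinit * ∑ s, ρ s * ∑ k ∈ Finset.range (P.r s), P.proxWeight ρ k =
        ∑ s, ρ s * (breg (diag m xs) zinit * ∑ k ∈ Finset.range (P.r s), P.proxWeight ρ k) := by
      rw [Finset.mul_sum]
      exact Finset.sum_congr rfl fun s _ => by ring
    rw [e1, e2, e3]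
    exact h2
  have hsum := Finset.sum_le_sum hprimal
  simp only [Finset.sum_add_distrib] at hsum hdual
  have hτ : ∑ s, P.tau ρ s / 2 * ‖w s‖ ^ 2 ≤ ∑ s, P.tau ρ s / 2 * c s ^ 2 :=
    Finset.sum_le_sum fun s _ => mul_le_mul_of_nonneg_left
      (pow_le_pow_left₀ (norm_nonneg _) (hw s) 2)
      (half_pos (tau_pos hS hP.K_ne hP.r_pos hρ.pos hμ s)).le
  have e1 : ∑ s, ∑ k ∈ Finset.range (N + 1), P.theta ρ k *
      inner ℝ (P.K s (Zhat k)) (w s - y s ((k / P.r s : ℕ) : ℤ)) =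
      ∑ k ∈ Finset.range (N + 1), P.theta ρ k *
        (P.F (Zhat k) - P.F (diag m xs) + ∑ s, inner ℝ (P.K s (Zhat k)) (w s))
      - ∑ k ∈ Finset.range (N + 1), P.theta ρ k *
        (∑ s, inner ℝ (P.K s (Zhat k)) (y s ((k / P.r s : ℕ) : ℤ)) + P.F (Zhat k)
          - P.F (diag m xs)) := by
    rw [Finset.sum_comm, ← Finset.sum_sub_distrib]
    refine Finset.sum_congr rfl fun k _ => ?_
    rw [← Finset.mul_sum]
    simp only [inner_sub_right, Finset.sum_sub_distrib]
    ring
  have e2 : ∑ s, ∑ k ∈ Finset.range (N + 1), P.proxWeight ρ k *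
      (ρ s * breg (Zhat k) (Z ((k : ℤ) - P.r s))) =
      ∑ k ∈ Finset.range (N + 1), P.proxWeight ρ k *
        ∑ s, ρ s * breg (Zhat k) (Z ((k : ℤ) - P.r s)) := by
    rw [Finset.sum_comm]
    exact Finset.sum_congr rfl fun k _ => (Finset.mul_sum _ _ _).symm
  rw [e1, e2] at hdual
  linarith

/-- The penalized gap of the averaged iterate. -/
theorem IsIterates.average_le (hP : P.IsRegular xs) (hρ : IsWeight ρ) {a : ℝ} (ha : 0 < a)
    (hsim : P.IsSimilar a) {c : Fin S → ℝ} (hc : ∀ s, 0 ≤ c s) {N : ℕ} (hN1 : 1 ≤ N)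
    {Zhat : ℤ → Lifted m d}
    (h : P.IsIterates a ρ (fun s y => c s * ‖y‖) N Zhat) :
    P.average ρ N Zhat ∈ P.lifted ∧
    (∑ k ∈ Finset.range (N + 1), P.theta ρ k) * (P.F (P.average ρ N Zhat) - P.F (diag m xs)
        + ∑ s, c s * ‖P.K s (P.average ρ N Zhat)‖) ≤
      ∑ s, P.tau ρ s / 2 * c s ^ 2 + 2 * a ^ 2 / P.μ *
        (P.moment ρ 3 / P.moment ρ 1 + 7 * (P.moment ρ 2 / P.moment ρ 1) ^ 2) := by
  obtain ⟨hN, T, T0, Dx, x0, zinit, Z, y, hT, hinit, hrun⟩ := h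
  have hμ := hP.μ_pos
  have hM := hP.M_pos
  have hS := hP.S_pos
  have hX := hP.convex_X
  have hm : (0 : ℝ) < m := by exact_mod_cast hP.m_pos
  have hR1 := moment_pos hS hP.r_pos hρ.pos 1
  have hR2 := moment_pos hS hP.r_pos hρ.pos 2
  have hR3 := moment_pos hS hP.r_pos hρ.pos 3
  have hN' : (1 : ℝ) ≤ N := by exact_mod_cast hN1
  have hT1 : 1 ≤ T := by
    have hD1pos : 0 < P.stepConst ρ a := by
      rw [stepConst]
      have := Real.sqrt_pos.2 hm
      positivity
    have h1 : 0 < (N : ℝ) * (5 / √(P.stepConst ρ a)) := by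
      have := Real.sqrt_pos.2 hD1pos
      positivity
    have h2 := (mul_le_mul_of_nonneg_left (le_max_left _ _) (by positivity)).trans hT
    exact_mod_cast h1.trans_le h2
  have hT0 : 1 ≤ T0 := by
    have h1 : 0 < 8 * P.M ^ 2 * m / (a ^ 2 / P.μ * P.μ) := by positivity
    exact_mod_cast h1.trans_le hinit.steps
  have hz := hinit.mem hX hT0
  have hD0 := hsim.breg_diag_le ha hμ hP.growth hX hP.m_pos hP.kernel hP.xs_mem hP.opt hz
    (hinit.F_le hX hμ hP.growth hP.m_pos ha hT0 hP.xs_mem)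
  have hmem : ∀ k ∈ Finset.range (N + 1), Zhat k ∈ P.lifted := fun k hk =>
    (hrun.mem_lifted hX hT1 hz
      (by exact_mod_cast Nat.lt_succ_iff.1 (Finset.mem_range.1 hk))).2
  have hθ : ∀ k ∈ Finset.range (N + 1), 0 ≤ P.theta ρ k := fun k _ =>
    (theta_pos hS hP.r_pos hρ.pos k).le
  set Θ := ∑ k ∈ Finset.range (N + 1), P.theta ρ k with hΘ
  have hΘpos : 0 < Θ := Finset.sum_pos (fun k _ => theta_pos hS hP.r_pos hρ.pos k)
    ⟨0, by simp⟩
  have havg : P.average ρ N Zhat = Θ⁻¹ • ∑ k ∈ Finset.range (N + 1), P.theta ρ k • Zhat k := rfl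
  refine ⟨(convex_lifted hX).centerMass_mem hθ hΘpos hmem, ?_⟩
  have hjensen := (convexOn_F hX hP.convexOn_f).map_centerMass_le hθ hΘpos hmem
  change P.F (P.average ρ N Zhat) ≤
    Θ⁻¹ • ∑ k ∈ Finset.range (N + 1), P.theta ρ k • P.F (Zhat k) at hjensen
  simp only [smul_eq_mul] at hjensen
  -- The dual point in the ball of radius c_s aligned with K_s X̄ turns the pairing into c_s‖K_s
  -- X̄‖. Division by zero gives w_s = 0, which is harmless when K_s X̄ = 0.
  set w : ∀ s, Vec (n s) := fun s =>
    (c s / ‖P.K s (P.average ρ N Zhat)‖) • P.K s (P.average ρ N Zhat) with hw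
  have hwc : ∀ s, ‖w s‖ ≤ c s := by
    intro s
    simp only [hw]
    rw [norm_smul, Real.norm_of_nonneg (div_nonneg (hc s) (norm_nonneg _))]
    by_cases h0 : ‖P.K s (P.average ρ N Zhat)‖ = 0
    · rw [h0, mul_zero]
      exact hc s
    · exact (div_mul_cancel₀ _ h0).le
  have hwi : ∀ s, inner ℝ (P.K s (P.average ρ N Zhat)) (w s) =
      c s * ‖P.K s (P.average ρ N Zhat)‖ := by
    intro s
    simp only [hw]
    rw [real_inner_smul_right, real_inner_self_eq_norm_sq]
    by_cases h0 : ‖P.K s (P.average ρ N Zhat)‖ = 0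
    · simp [h0]
    · field_simp
  have hgap := hrun.sum_gap_le hP hρ hc hN hT1 hz hwc
  have herr := hP.sum_slidingErr_le hρ ha hN hN1 hT1 hT
  have hprox := sum_range_proxWeight_le hS hP.r_pos hρ.pos hμ
  have hprox' : breg (diag m xs) zinit *
      ∑ s, ρ s * ∑ k ∈ Finset.range (P.r s), P.proxWeight ρ k ≤
      4 * a ^ 2 / P.μ ^ 2 * (P.μ / (2 * P.moment ρ 1) *
        (P.moment ρ 3 / 3 + 7 / 2 * (P.moment ρ 2 ^ 2 / P.moment ρ 1))) := by
    refine mul_le_mul hD0 hprox (Finset.sum_nonneg fun s _ => mul_nonneg (hρ.pos s).le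
      (Finset.sum_nonneg fun k _ => proxWeight_nonneg hS hP.r_pos hρ.pos hμ k)) (by positivity)
  have e1 : 4 * a ^ 2 / P.μ ^ 2 * (P.μ / (2 * P.moment ρ 1) *
        (P.moment ρ 3 / 3 + 7 / 2 * (P.moment ρ 2 ^ 2 / P.moment ρ 1))) =
      2 / 3 * (a ^ 2 / P.μ * (P.moment ρ 3 / P.moment ρ 1))
        + 7 * (a ^ 2 / P.μ * (P.moment ρ 2 / P.moment ρ 1) ^ 2) := by
    field_simp
    ring
  have e2 : 2 * a ^ 2 / P.μ *
        (P.moment ρ 3 / P.moment ρ 1 + 7 * (P.moment ρ 2 / P.moment ρ 1) ^ 2) =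
      2 * (a ^ 2 / P.μ * (P.moment ρ 3 / P.moment ρ 1))
        + 14 * (a ^ 2 / P.μ * (P.moment ρ 2 / P.moment ρ 1) ^ 2) := by
    ring
  have e3 : 2 * (P.moment ρ 2 / P.moment ρ 1) ^ 2 * a ^ 2 / P.μ =
      2 * (a ^ 2 / P.μ * (P.moment ρ 2 / P.moment ρ 1) ^ 2) := by
    ring
  have h1 : 0 ≤ a ^ 2 / P.μ * (P.moment ρ 3 / P.moment ρ 1) := by positivity
  have h2 : 0 ≤ a ^ 2 / P.μ * (P.moment ρ 2 / P.moment ρ 1) ^ 2 := by positivity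
  rw [e1] at hprox'
  rw [e3] at herr
  rw [e2]
  refine le_trans ?_ (hgap.trans (by linarith))
  have e4 : ∑ k ∈ Finset.range (N + 1), P.theta ρ k *
        (P.F (Zhat k) - P.F (diag m xs) + ∑ s, inner ℝ (P.K s (Zhat k)) (w s)) =
      ∑ k ∈ Finset.range (N + 1), P.theta ρ k * P.F (Zhat k) - Θ * P.F (diag m xs)
        + Θ * ∑ s, inner ℝ (P.K s (P.average ρ N Zhat)) (w s) := by
    have h3 : ∀ s, Θ * inner ℝ (P.K s (P.average ρ N Zhat)) (w s) =
        ∑ k ∈ Finset.range (N + 1), P.theta ρ k * inner ℝ (P.K s (Zhat k)) (w s) := by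
      intro s
      rw [havg, map_smul, real_inner_smul_left, mul_inv_cancel_left₀ hΘpos.ne', map_sum, sum_inner]
      exact Finset.sum_congr rfl fun k _ => by rw [map_smul, real_inner_smul_left]
    rw [Finset.mul_sum Finset.univ, Finset.sum_congr rfl fun s _ => h3 s, Finset.sum_comm, hΘ,
      Finset.sum_mul, ← Finset.sum_sub_distrib, ← Finset.sum_add_distrib]
    refine Finset.sum_congr rfl fun k _ => ?_
    rw [← Finset.mul_sum]
    ring
  rw [e4, Finset.sum_congr rfl fun s _ => hwi s]
  have h3 := mul_le_mul_of_nonneg_left hjensen hΘpos.le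
  rw [mul_inv_cancel_left₀ hΘpos.ne'] at h3
  linarith

theorem rateConst_pos {a A₀ : ℝ} (ha : 0 < a) (hA : 0 < A₀) : 0 < P.rateConst ρ a A₀ := by
  rw [rateConst]
  positivity

theorem IsRegular.iterBound_pos (hP : P.IsRegular xs) (hρ : IsWeight ρ) {a A₀ ε : ℝ} (ha : 0 < a)
    (hA : 0 < A₀) (hε : 0 < ε) : 0 < P.iterBound ρ a A₀ ε := by
  have h1 := moment_pos hP.S_pos hP.r_pos hρ.pos 1
  have h2 := rateConst_pos (P := P) (ρ := ρ) ha hA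
  have h3 := Real.sqrt_pos.2 (mul_pos hP.μ_pos hε)
  rw [iterBound]
  positivity

/-- The relation ρ_s A₀ = ‖K_s‖c_s makes ∑ τ_s c_s²/2 collapse to 2r̄²A₀²/μ. The whole error is then
at most 2r̄²A²/μ, and the threshold on N makes this at most εN²/2 ≤ ε∑θ_k. -/
theorem IsIterates.penalized_le (hP : P.IsRegular xs) (hρ : IsWeight ρ) {a A₀ ε : ℝ} (ha : 0 < a)
    (hsim : P.IsSimilar a) {c : Fin S → ℝ} (hc : ∀ s, 0 ≤ c s) (hA : 0 < A₀) (hε : 0 < ε)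
    (hρA : ∀ s, ρ s * A₀ = ‖P.K s‖ * c s) {N : ℕ} (hN : P.iterBound ρ a A₀ ε ≤ N)
    {Zhat : ℤ → Lifted m d} (h : P.IsIterates a ρ (fun s y => c s * ‖y‖) N Zhat) :
    P.average ρ N Zhat ∈ P.lifted ∧
    P.F (P.average ρ N Zhat) + ∑ s, c s * ‖P.K s (P.average ρ N Zhat)‖ ≤
      P.F (diag m xs) + ε := by
  have hμ := hP.μ_pos
  have hR1 := moment_pos hP.S_pos hP.r_pos hρ.pos 1
  have hR2 := moment_pos hP.S_pos hP.r_pos hρ.pos 2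
  have hR3 := moment_pos hP.S_pos hP.r_pos hρ.pos 3
  have hN1 : 1 ≤ N := by exact_mod_cast (hP.iterBound_pos hρ ha hA hε).trans_le hN
  have hN' : (1 : ℝ) ≤ N := by exact_mod_cast hN1
  obtain ⟨hmem, hle⟩ := h.average_le hP hρ ha hsim hc hN1
  refine ⟨hmem, ?_⟩
  have hτ : ∑ s, P.tau ρ s / 2 * c s ^ 2 = 2 * P.moment ρ 1 ^ 2 * A₀ ^ 2 / P.μ := by
    have e : ∀ s, P.tau ρ s / 2 * c s ^ 2 =
        2 * P.moment ρ 1 * A₀ ^ 2 / P.μ * (ρ s * (P.r s : ℝ) ^ 1) := by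
      intro s
      have hs := (hρ.pos s).ne'
      have e1 : P.tau ρ s / 2 * c s ^ 2 =
          (‖P.K s‖ * c s) ^ 2 / ρ s * (2 * P.r s * P.moment ρ 1 / P.μ) := by
        rw [tau]
        ring
      rw [e1, ← hρA]
      field_simp
    rw [Finset.sum_congr rfl fun s _ => e s, ← Finset.mul_sum]
    change _ * P.moment ρ 1 = _
    ring
  have hA2 : P.moment ρ 1 ^ 2 * A₀ ^ 2 + a ^ 2 *
      (P.moment ρ 3 / P.moment ρ 1 + 7 * (P.moment ρ 2 / P.moment ρ 1) ^ 2) ≤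
      P.moment ρ 1 ^ 2 * P.rateConst ρ a A₀ ^ 2 := by
    set κ := P.moment ρ 3 / P.moment ρ 1 ^ 3 + 7 * (P.moment ρ 2 / P.moment ρ 1 ^ 2) ^ 2 with hκ
    have e : P.moment ρ 3 / P.moment ρ 1 + 7 * (P.moment ρ 2 / P.moment ρ 1) ^ 2 =
        P.moment ρ 1 ^ 2 * κ := by
      rw [hκ]
      field_simp
    have hκ0 : 0 ≤ κ := by positivity
    have e2 : P.rateConst ρ a A₀ ^ 2 = κ * a ^ 2 + A₀ ^ 2 + 2 * √κ * a * A₀ := by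
      rw [rateConst, ← hκ, add_sq, mul_pow, Real.sq_sqrt hκ0]
      ring
    rw [e, e2]
    have h0 : 0 ≤ P.moment ρ 1 ^ 2 * (2 * √κ * a * A₀) := by positivity
    linarith
  have hN2 : 4 * (P.moment ρ 1 ^ 2 * P.rateConst ρ a A₀ ^ 2) ≤ N ^ 2 * (P.μ * ε) := by
    have hpos : 0 < P.μ * ε := mul_pos hμ hε
    have h1 := rateConst_pos (P := P) (ρ := ρ) ha hA
    rw [iterBound, div_le_iff₀ (Real.sqrt_pos.2 hpos)] at hN
    have h2 := pow_le_pow_left₀ (by positivity) hN 2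
    rw [mul_pow (N : ℝ), Real.sq_sqrt hpos.le] at h2
    linarith
  have hΘ : (N : ℝ) ^ 2 / 2 ≤ ∑ k ∈ Finset.range (N + 1), P.theta ρ k := by
    rw [sum_theta]
    have : 0 ≤ 2 * ((N : ℝ) + 1) * (P.moment ρ 2 / P.moment ρ 1) := by positivity
    linarith
  set Θ := ∑ k ∈ Finset.range (N + 1), P.theta ρ k
  have hrhs : ∑ s, P.tau ρ s / 2 * c s ^ 2 + 2 * a ^ 2 / P.μ *
      (P.moment ρ 3 / P.moment ρ 1 + 7 * (P.moment ρ 2 / P.moment ρ 1) ^ 2) ≤ Θ * ε := by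
    rw [hτ]
    have e : 2 * P.moment ρ 1 ^ 2 * A₀ ^ 2 / P.μ + 2 * a ^ 2 / P.μ *
        (P.moment ρ 3 / P.moment ρ 1 + 7 * (P.moment ρ 2 / P.moment ρ 1) ^ 2) =
        2 * (P.moment ρ 1 ^ 2 * A₀ ^ 2 + a ^ 2 *
          (P.moment ρ 3 / P.moment ρ 1 + 7 * (P.moment ρ 2 / P.moment ρ 1) ^ 2)) / P.μ := by
      ring
    rw [e, div_le_iff₀ hμ]
    have h1 := mul_le_mul_of_nonneg_right hΘ (mul_pos hμ hε).le
    linarith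
  have hΘpos : 0 < Θ := by
    have : 0 < (N : ℝ) ^ 2 / 2 := by positivity
    linarith
  have := le_of_mul_le_mul_left (hle.trans hrhs) hΘpos
  linarith

/-! ### Solutions -/

theorem IsRegular.F_diag_le (hP : P.IsRegular xs) {Z : Lifted m d} (hZ : Z ∈ P.lifted) :
    P.F (diag m xs) ≤ P.F (consensus Z) := by
  have h := F_diag_add_le hP.growth hP.convex_X hP.m_pos hP.xs_mem hP.opt hZ
  have hμ := hP.μ_pos
  have : 0 ≤ P.μ / 2 * ‖consensus Z - diag m xs‖ ^ 2 := by positivity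
  linarith

/-- Optimality gives F(X*) ≤ F(ΠZ) ≤ F(Z) + e. The part e of the penalty cancels this possible gain,
and what remains is ξ‖Z - ΠZ‖ ≤ ε. -/
theorem IsRegular.isSolution (hP : P.IsRegular xs) {Z : Lifted m d} (hZ : Z ∈ P.lifted)
    {ξ ε e p : ℝ} (hξ : 0 < ξ) (he : 0 ≤ e) (hF : P.F (consensus Z) ≤ P.F Z + e)
    (hp : ξ * ‖Z - consensus Z‖ + e ≤ p) (h : P.F Z + p ≤ P.F (diag m xs) + ε) :
    P.IsSolution xs ε (ε / ξ) Z := by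
  have h1 := hP.F_diag_le hZ
  have h2 : 0 ≤ ξ * ‖Z - consensus Z‖ := by positivity
  refine ⟨hZ, by linarith, ?_⟩
  rw [le_div_iff₀ hξ]
  linarith

/-- Projecting raises F by at most e, which the penalty already contains; the extra ξe is
nonnegative and may be discarded. -/
theorem IsRegular.isSolution_consensus (hP : P.IsRegular xs) {Z : Lifted m d} (hZ : Z ∈ P.lifted)
    {ξ ε e p : ℝ} (hξ : 0 < ξ) (hε : 0 < ε) (he : 0 ≤ e) (hF : P.F (consensus Z) ≤ P.F Z + e)
    (hp : (1 + ξ) * e ≤ p) (h : P.F Z + p ≤ P.F (diag m xs) + ε) :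
    P.IsSolution xs (ε * (1 + 1 / ξ)) 0 (consensus Z) := by
  have h1 : 0 ≤ ξ * e := by positivity
  have h2 : 0 ≤ ε * (1 / ξ) := by positivity
  refine ⟨fun _ => consensus_mem hP.m_pos hP.convex_X hZ, by linarith, ?_⟩
  rw [consensus_consensus hP.m_pos, sub_self, norm_zero]

theorem IsRegular.sigma_pos (hP : P.IsRegular xs) : 0 < P.sigma :=
  sigmaMinPos_pos (stacked_ne_zero hP.S_pos hP.K_ne)

theorem IsRegular.sigmaBlock_pos (hP : P.IsRegular xs) (s : Fin S) : 0 < P.sigmaBlock s :=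
  sigmaMinPos_pos (hP.K_ne s)

theorem IsRegular.sigma_mul_le (hP : P.IsRegular xs) (Z : Lifted m d) :
    P.sigma * ‖Z - consensus Z‖ ≤ ∑ s, ‖P.K s Z‖ := by
  rw [← hP.kernel.rowProj_stacked hP.m_pos]
  exact (sigmaMinPos_mul_le _ _).trans (norm_stacked_le Z)

theorem IsRegular.mul_norm_le_penalty (hP : P.IsRegular xs) {b : ℝ} (hb : 0 ≤ b)
    (Z : Lifted m d) : b * ‖Z - consensus Z‖ ≤ ∑ s, b / P.sigma * ‖P.K s Z‖ := by
  rw [← Finset.mul_sum]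
  have h := mul_le_mul_of_nonneg_left (hP.sigma_mul_le Z) (div_nonneg hb hP.sigma_pos.le)
  rwa [← mul_assoc, div_mul_cancel₀ _ hP.sigma_pos.ne'] at h

theorem IsRegular.sum_mul_norm_le_penalty (hP : P.IsRegular xs) {b : Fin S → ℝ}
    (hb : ∀ s, 0 ≤ b s) (Z : Lifted m d) :
    ∑ s, b s * ‖rowProj (P.K s) Z‖ ≤ ∑ s, b s / P.sigmaBlock s * ‖P.K s Z‖ := by
  refine Finset.sum_le_sum fun s _ => ?_
  have h := mul_le_mul_of_nonneg_left (sigmaMinPos_mul_le (P.K s) Z)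
    (div_nonneg (hb s) (hP.sigmaBlock_pos s).le)
  change _ * (P.sigmaBlock s * _) ≤ _ at h
  rwa [← mul_assoc, div_mul_cancel₀ _ (hP.sigmaBlock_pos s).ne'] at h

theorem IsRegular.sum_norm_pos (hP : P.IsRegular xs) {c : Fin S → ℝ} (hc : ∀ s, 0 < c s) :
    0 < ∑ s, ‖P.K s‖ * c s :=
  Finset.sum_pos (fun s _ => mul_pos (norm_pos_iff.2 (hP.K_ne s)) (hc s))
    ⟨⟨0, hP.S_pos⟩, Finset.mem_univ _⟩

theorem IsRegular.isWeight_blockWeights (hP : P.IsRegular xs) {c : Fin S → ℝ}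
    (hc : ∀ s, 0 < c s) : IsWeight (P.blockWeights c) where
  pos s := div_pos (mul_pos (norm_pos_iff.2 (hP.K_ne s)) (hc s)) (hP.sum_norm_pos hc)
  sum_eq_one := by
    simp only [blockWeights]
    rw [← Finset.sum_div, div_self (hP.sum_norm_pos hc).ne']

theorem IsRegular.blockWeights_mul (hP : P.IsRegular xs) {c : Fin S → ℝ}
    (hc : ∀ s, 0 < c s) (s : Fin S) :
    P.blockWeights c s * ∑ s', ‖P.K s'‖ * c s' = ‖P.K s‖ * c s :=
  div_mul_cancel₀ _ (hP.sum_norm_pos hc).ne'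

theorem normWeights_eq : P.normWeights = P.blockWeights fun _ => 1 := by
  ext s
  simp [normWeights, blockWeights]

/-- Take N + 1 to be the multiple of the lcm obtained by rounding B + 1 up. Counting every time up
to N as a communication round is already enough. -/
theorem roundsAtMost (hr : ∀ s, 0 < P.r s) {B : ℝ} (hB : 0 ≤ B) : P.RoundsAtMost B := by
  set L := Finset.univ.lcm P.r with hL
  have hLpos : 0 < L := Nat.pos_of_ne_zero fun h => by
    obtain ⟨s, -, hs⟩ := Finset.lcm_eq_zero_iff.1 h
    exact (hr s).ne' hs
  have hLpos' : (0 : ℝ) < L := by exact_mod_cast hLpos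
  set q := ⌈(B + 1) / L⌉₊ with hq
  have hqpos : 0 < q := Nat.ceil_pos.2 (by positivity)
  have hqle : B + 1 ≤ L * q := by
    rw [← div_le_iff₀' hLpos']
    exact Nat.le_ceil _
  have hqlt : (L : ℝ) * q < B + 1 + L := by
    have := mul_lt_mul_of_pos_left (Nat.ceil_lt_add_one (by positivity : 0 ≤ (B + 1) / L)) hLpos'
    rwa [mul_add, mul_one, mul_div_cancel₀ _ hLpos'.ne'] at this
  obtain ⟨N, hN⟩ : ∃ N, L * q = N + 1 :=
    ⟨L * q - 1, (Nat.sub_add_cancel (Nat.mul_pos hLpos hqpos)).symm⟩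
  have hN' : (L : ℝ) * q = N + 1 := by exact_mod_cast hN
  refine ⟨N, fun s => ?_, by linarith, ?_⟩
  · rw [← hN]
    exact (Finset.dvd_lcm (Finset.mem_univ s)).mul_right q
  · have h : P.commRounds N ≤ N + 1 := by
      rw [commRounds]
      exact (Finset.card_filter_le _ _).trans (Finset.card_range _).le
    have h' : (P.commRounds N : ℝ) ≤ N + 1 := by exact_mod_cast h
    linarith

end Problem

end AMT

/-! ### The four choices of penalties and weights. -/

theorem corollary9 {m d S : ℕ} {n : Fin S → ℕ} (P : AMT.Problem m d S n)
    (hX_closed : IsClosed P.X) (hX_convex : Convex ℝ P.X)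
    (hf_convex : ∀ v, ConvexOn ℝ P.X (P.f v))
    (hμ : 0 < P.μ) (hM : 0 < P.M) (hgrowth : P.GrowthCondition)
    (hS : 0 < S) (hK_ne : ∀ s, P.K s ≠ 0) (hkernel : P.KernelCondition)
    (hr : ∀ s, 0 < P.r s)
    (xs : AMT.Vec d) (hxs : xs ∈ P.X) (hopt : IsMinOn (fun x => ∑ v, P.f v x) P.X xs)
    (ξ ε : ℝ) (hξ : 0 < ξ) (hε : 0 < ε) :
    -- similarity without orthogonality
    (∀ a : ℝ, 0 < a → P.IsSimilar a →
      -- the penalties for small constraint violation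
      ((∀ (N : ℕ) (Zhat : ℤ → AMT.Lifted m d),
          P.iterBound P.normWeights a ((∑ s, ‖P.K s‖) / P.sigma * (ξ + a)) ε ≤ N →
          P.IsIterates a P.normWeights (fun _ y => (ξ + a) / P.sigma * ‖y‖) N Zhat →
          P.IsSolution xs ε (ε / ξ) (P.average P.normWeights N Zhat)) ∧
        P.RoundsAtMost (P.iterBound P.normWeights a ((∑ s, ‖P.K s‖) / P.sigma * (ξ + a)) ε)) ∧
      -- the penalties for the projected solution
      ((∀ (N : ℕ) (Zhat : ℤ → AMT.Lifted m d),
          P.iterBound P.normWeights a ((1 + ξ) * (∑ s, ‖P.K s‖) * a / P.sigma) ε ≤ N →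
          P.IsIterates a P.normWeights (fun _ y => (1 + ξ) * a / P.sigma * ‖y‖) N Zhat →
          P.IsSolution xs (ε * (1 + 1 / ξ)) 0
            (AMT.consensus (P.average P.normWeights N Zhat))) ∧
        P.RoundsAtMost (P.iterBound P.normWeights a ((1 + ξ) * (∑ s, ‖P.K s‖) * a / P.sigma) ε))) ∧
    -- similarity along orthogonal blocks
    (∀ a : Fin S → ℝ, (∀ s, 0 < a s) → P.IsBlockSimilar a →
      -- the penalties for small constraint violation
      (∀ ρ : Fin S → ℝ, ρ = P.blockWeights (fun s => (ξ + a s) / P.sigmaBlock s) →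
        (∀ (N : ℕ) (Zhat : ℤ → AMT.Lifted m d),
          P.iterBound ρ √(∑ s, a s ^ 2)
            (∑ s, (ξ + a s) * (‖P.K s‖ / P.sigmaBlock s)) ε ≤ N →
          P.IsIterates √(∑ s, a s ^ 2) ρ (fun s y => (ξ + a s) / P.sigmaBlock s * ‖y‖) N Zhat →
          P.IsSolution xs ε (ε / ξ) (P.average ρ N Zhat)) ∧
        P.RoundsAtMost (P.iterBound ρ √(∑ s, a s ^ 2)
          (∑ s, (ξ + a s) * (‖P.K s‖ / P.sigmaBlock s)) ε)) ∧
      -- the penalties for the projected solution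
      (∀ ρ : Fin S → ℝ, ρ = P.blockWeights (fun s => a s / P.sigmaBlock s) →
        (∀ (N : ℕ) (Zhat : ℤ → AMT.Lifted m d),
          P.iterBound ρ √(∑ s, a s ^ 2)
            ((1 + ξ) * ∑ s, a s * (‖P.K s‖ / P.sigmaBlock s)) ε ≤ N →
          P.IsIterates √(∑ s, a s ^ 2) ρ
            (fun s y => (1 + ξ) * a s / P.sigmaBlock s * ‖y‖) N Zhat →
          P.IsSolution xs (ε * (1 + 1 / ξ)) 0 (AMT.consensus (P.average ρ N Zhat))) ∧
        P.RoundsAtMost (P.iterBound ρ √(∑ s, a s ^ 2)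
          ((1 + ξ) * ∑ s, a s * (‖P.K s‖ / P.sigmaBlock s)) ε))) := by
  have hP : P.IsRegular xs := ⟨hX_convex, hf_convex, hμ, hM, hgrowth, hS, hK_ne, hkernel, hr,
    hxs, hopt⟩
  have hσ := hP.sigma_pos
  have hσs := hP.sigmaBlock_pos
  refine ⟨fun a ha hsim => ?_, fun a ha hsim => ?_⟩
  · have hρ : AMT.Problem.IsWeight P.normWeights := by
      rw [AMT.Problem.normWeights_eq]
      exact hP.isWeight_blockWeights fun _ => one_pos
    have hKpos : 0 < ∑ s, ‖P.K s‖ := by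
      simpa using hP.sum_norm_pos (c := fun _ => 1) fun _ => one_pos
    have hmul : ∀ s, P.normWeights s * ∑ s', ‖P.K s'‖ = ‖P.K s‖ := fun s =>
      div_mul_cancel₀ _ hKpos.ne'
    -- This a‖Z - ΠZ‖ is the loss e of projecting; in the block case its role is taken by ∑ a_s‖Π_s
    -- Z‖.
    have hF : ∀ Z ∈ P.lifted, P.F (AMT.consensus Z) ≤ P.F Z + a * ‖Z - AMT.consensus Z‖ := by
      intro Z hZ
      have h := hsim.F_consensus_le hgrowth hX_convex hP.m_pos hkernel hZ
      have : 0 ≤ P.μ / 2 * ‖Z - AMT.consensus Z‖ ^ 2 := by positivity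
      linarith
    constructor
    · have hA : 0 < (∑ s, ‖P.K s‖) / P.sigma * (ξ + a) := by positivity
      refine ⟨fun N Zhat hN h => ?_,
        AMT.Problem.roundsAtMost hr (hP.iterBound_pos hρ ha hA hε).le⟩
      obtain ⟨hmem, hle⟩ := h.penalized_le hP hρ ha hsim (fun _ => by positivity) hA hε
        (fun s => by rw [div_mul_eq_mul_div, mul_div_assoc, ← mul_assoc, hmul]) hN
      refine hP.isSolution hmem hξ (by positivity) (hF _ hmem) ?_ hle
      rw [← add_mul]
      exact hP.mul_norm_le_penalty (by positivity) _
    · have hA : 0 < (1 + ξ) * (∑ s, ‖P.K s‖) * a / P.sigma := by positivity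
      refine ⟨fun N Zhat hN h => ?_,
        AMT.Problem.roundsAtMost hr (hP.iterBound_pos hρ ha hA hε).le⟩
      obtain ⟨hmem, hle⟩ := h.penalized_le hP hρ ha hsim (fun _ => by positivity) hA hε
        (fun s => by
          rw [← hmul s]
          ring) hN
      refine hP.isSolution_consensus hmem hξ hε (by positivity) (hF _ hmem) ?_ hle
      rw [← mul_assoc]
      exact hP.mul_norm_le_penalty (by positivity) _
  · have hsim' := hsim.isSimilar hkernel hP.m_pos
    have haS : 0 < √(∑ s, a s ^ 2) := Real.sqrt_pos.2
      (Finset.sum_pos (fun s _ => pow_pos (ha s) 2) ⟨⟨0, hS⟩, Finset.mem_univ _⟩)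
    have hF : ∀ Z ∈ P.lifted, P.F (AMT.consensus Z) ≤
        P.F Z + ∑ s, a s * ‖AMT.rowProj (P.K s) Z‖ := fun Z hZ =>
      hsim.F_consensus_le hμ hgrowth hX_convex hP.m_pos hkernel hZ
    have hrow : ∀ Z, 0 ≤ ∑ s, a s * ‖AMT.rowProj (P.K s) Z‖ := fun Z =>
      Finset.sum_nonneg fun s _ => mul_nonneg (ha s).le (norm_nonneg _)
    constructor
    · rintro ρ rfl
      have hc : ∀ s, 0 < (ξ + a s) / P.sigmaBlock s := fun s =>
        div_pos (add_pos hξ (ha s)) (hσs s)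
      have hρ := hP.isWeight_blockWeights hc
      have hA0 : ∑ s, (ξ + a s) * (‖P.K s‖ / P.sigmaBlock s) =
          ∑ s, ‖P.K s‖ * ((ξ + a s) / P.sigmaBlock s) :=
        Finset.sum_congr rfl fun s _ => by ring
      have hA := hP.sum_norm_pos hc
      rw [hA0]
      refine ⟨fun N Zhat hN h => ?_,
        AMT.Problem.roundsAtMost hr (hP.iterBound_pos hρ haS hA hε).le⟩
      obtain ⟨hmem, hle⟩ := h.penalized_le hP hρ haS hsim' (fun s => (hc s).le) hA hε
        (hP.blockWeights_mul hc) hN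
      refine hP.isSolution hmem hξ (hrow _) (hF _ hmem) ?_ hle
      refine le_trans ?_ (hP.sum_mul_norm_le_penalty (fun s => (add_pos hξ (ha s)).le) _)
      -- Splitting Z - ΠZ into its block components and using the triangle inequality distributes ξ
      -- over the block penalties.
      rw [← hkernel.sum_rowProj hP.m_pos hsim.1]
      simp only [add_mul, Finset.sum_add_distrib, ← Finset.mul_sum]
      exact add_le_add_left (mul_le_mul_of_nonneg_left (norm_sum_le _ _) hξ.le) _
    · rintro ρ rfl
      have hc : ∀ s, 0 < a s / P.sigmaBlock s := fun s => div_pos (ha s) (hσs s)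
      have hρ := hP.isWeight_blockWeights hc
      have hA0 : ∑ s, a s * (‖P.K s‖ / P.sigmaBlock s) =
          ∑ s, ‖P.K s‖ * (a s / P.sigmaBlock s) :=
        Finset.sum_congr rfl fun s _ => by ring
      have hξ1 : 0 < 1 + ξ := by positivity
      have hA := mul_pos hξ1 (hP.sum_norm_pos hc)
      rw [hA0]
      refine ⟨fun N Zhat hN h => ?_,
        AMT.Problem.roundsAtMost hr (hP.iterBound_pos hρ haS hA hε).le⟩
      obtain ⟨hmem, hle⟩ := h.penalized_le hP hρ haS hsim'
        (fun s => (div_pos (mul_pos hξ1 (ha s)) (hσs s)).le) hA hε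
        (fun s => by
          rw [mul_left_comm, hP.blockWeights_mul hc]
          ring) hN
      refine hP.isSolution_consensus hmem hξ hε (hrow _) (hF _ hmem) ?_ hle
      refine le_trans (le_of_eq ?_)
        (hP.sum_mul_norm_le_penalty (fun s => (mul_pos hξ1 (ha s)).le) _)
      rw [Finset.mul_sum]
      exact Finset.sum_congr rfl fun s _ => by ring
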